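/- Let $\mathcal K,\mathcal H,\mathcal H_1,\mathcal H_2$ be separable complex Hilbert spaces, $\mathcal L(\cdot)$ the bounded operators and $\mathcal T(\cdot)$ the trace class operators on a Hilbert space; $\mathcal H_1\otimes\mathcal H_2$ is the Hilbert space tensor product. Let $(\Omega,\Sigma)$, $(\Omega',\Sigma')$ be measurable spaces with $\sigma$-finite measures $\nu$, $\nu'$. A state is a positive trace class operator of trace $1$; $\mathcal S(\mathcal H)$ is the set of states. A channel in $\mathcal C(\mathcal K;\mathcal H)$ is a unital, ultraweakly continuous (normal), completely positive linear map $\mathcal E:\mathcal L(\mathcal K)\to\mathcal L(\mathcal H)$; a Schrödinger channel $\mathcal T(\mathcal H)\to\mathcal T(\mathcal K)$ is a linear map $\mathcal F$ for which there is $\mathcal E\in\mathcal C(\mathcal K;\mathcal H)$ with $\mathrm{tr}[\mathcal F(T)B]=\mathrm{tr}[T\mathcal E(B)]$ for all $T,B$. An observable in $\mathcal O_\Sigma(\mathcal H)$ is a normalized positive operator valued measure (POVM) on $\Sigma$ with values in $\mathcal L(\mathcal H)$; $\mathcal O_\nu(\mathcal H)$ is the set of those which vanish on $\nu$-null sets.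 It is sharp if all its values are projections. An instrument in $\mathcal I_\Sigma(\mathcal K;\mathcal H)$ is a map $\Gamma:\Sigma\times\mathcal L(\mathcal K)\to\mathcal L(\mathcal H)$ such that every $\Gamma(\cdot,B)$ is a (weakly countably additive) operator measure, $\Gamma(\cdot,I)$ is a POVM, every $\Gamma(X,\cdot)$ is linear, normal and completely positive, and $\Gamma(\Omega,\cdot)\in\mathcal C(\mathcal K;\mathcal H)$; $\mathcal I_\nu(\mathcal K;\mathcal H)$ is the set of those with $\Gamma(X,\cdot)=0$ whenever $\nu(X)=0$. Extremal means: extreme point of the respective convex set; an extremal state is called pure. (a) Let $\varrho\in\mathcal S(\mathcal H_1\otimes\mathcal H_2)$ with partial traces $\varrho_1=\mathrm{tr}_{\mathcal H_2}[\varrho]$ and $\varrho_2=\mathrm{tr}_{\mathcal H_1}[\varrho]$. If $\varrho_1$ or $\varrho_2$ is pure, then $\varrho=\varrho_1\otimes\varrho_2$. (b)&(e) Let $\mathsf M_1\in\mathcal O_\nu(\mathcal H)$ and $\mathsf M_2\in\mathcal O_{\nu'}(\mathcal H)$ be jointly measurable, i.e. suppose that they have a joint observable: some $\mathsf M\in\mathcal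 O_{\nu\times\nu'}(\mathcal H)$ with $\mathsf M(X\times\Omega')=\mathsf M_1(X)$ and $\mathsf M(\Omega\times Y)=\mathsf M_2(Y)$ for all $X\in\Sigma$, $Y\in\Sigma'$. If $\mathsf M_1$ is extremal in $\mathcal O_\nu(\mathcal H)$ or $\mathsf M_2$ is extremal in $\mathcal O_{\nu'}(\mathcal H)$, then the joint observable is unique. If both are extremal, then the joint observable is extremal in $\mathcal O_{\nu\times\nu'}(\mathcal H)$. If $\mathsf M_1$ or $\mathsf M_2$ is sharp, then $\mathsf M_1(X)\mathsf M_2(Y)=\mathsf M_2(Y)\mathsf M_1(X)$ for all $X\in\Sigma$, $Y\in\Sigma'$, the joint observable is unique, and an $\mathsf M\in\mathcal O_{\nu\times\nu'}(\mathcal H)$ is this joint observable if and only if $\mathsf M(X\times Y)=\mathsf M_1(X)\mathsf M_2(Y)$ for all $X\in\Sigma$, $Y\in\Sigma'$. The same holds with $\mathcal O_\Sigma(\mathcal H)$, $\mathcal O_{\Sigma'}(\mathcal H)$, $\mathcal O_{\Sigma\otimes\Sigma'}(\mathcal H)$ in place of $\mathcal O_\nu(\mathcal H)$, $\mathcal O_{\nu'}(\mathcal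 H)$, $\mathcal O_{\nu\times\nu'}(\mathcal H)$. (c)&(f) Let $\mathsf M\in\mathcal O_\nu(\mathcal H)$ and $\mathcal E\in\mathcal C(\mathcal K;\mathcal H)$ be compatible, i.e. suppose that they have a joint instrument: some $\Gamma\in\mathcal I_\nu(\mathcal K;\mathcal H)$ with $\Gamma(\cdot,I)=\mathsf M$ and $\Gamma(\Omega,\cdot)=\mathcal E$. If $\mathsf M$ is extremal in $\mathcal O_\nu(\mathcal H)$ or $\mathcal E$ is extremal in $\mathcal C(\mathcal K;\mathcal H)$, then the joint instrument is unique. If both are extremal, then the joint instrument is extremal in $\mathcal I_\nu(\mathcal K;\mathcal H)$. If $\mathsf M$ is sharp or $\mathcal E$ is a *-representation, then $\mathsf M(X)\mathcal E(B)=\mathcal E(B)\mathsf M(X)$ for all $X\in\Sigma$, $B\in\mathcal L(\mathcal K)$, the joint instrument $\Gamma$ is unique, and $$\Gamma(X,B)=\mathsf M(X)\mathcal E(B)=\sqrt{\mathsf M(X)}\,\mathcal E(B)\sqrt{\mathsf M(X)},\qquad X\in\Sigma,\ B\in\mathcal L(\mathcal K).$$ The same holds with $\mathcal O_\Sigma(\mathcal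 H)$ and $\mathcal I_\Sigma(\mathcal K;\mathcal H)$ in place of $\mathcal O_\nu(\mathcal H)$ and $\mathcal I_\nu(\mathcal K;\mathcal H)$. (d) Let $\mathcal H\neq\{0\}$ and let $\mathcal F:\mathcal T(\mathcal H)\to\mathcal T(\mathcal H\otimes\mathcal H)$ be a Schrödinger channel such that the partial trace of $\mathcal F(T)$ over one fixed tensor factor (the first or the second) equals $T$ for all $T\in\mathcal T(\mathcal H)$. Then there is a state $\sigma\in\mathcal S(\mathcal H)$ such that the partial trace of $\mathcal F(T)$ over the other factor equals $\mathrm{tr}[T]\,\sigma$ for all $T\in\mathcal T(\mathcal H)$. -/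

import Mathlib

open MeasureTheory TensorProduct
open scoped ComplexOrder InnerProductSpace

noncomputable section

namespace QJoint

universe u v w

section TraceClass

variable (H : Type u) [NormedAddCommGroup H] [InnerProductSpace ℂ H] [CompleteSpace H]

/-- The index set of a fixed orthonormal (Hilbert) basis of `H`. -/
def basisIndex : Set H := (exists_hilbertBasis ℂ H).choose

/-- A fixed orthonormal (Hilbert) basis of `H`. -/
def basis : HilbertBasis (basisIndex H) ℂ H := (exists_hilbertBasis ℂ H).choose_spec.choose

/-- The trace class `𝒯(H)`: the linear span of the positive operators of finite trace. -/
def traceClass : Submodule ℂ (H →L[ℂ] H) :=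
  Submodule.span ℂ {T | 0 ≤ T ∧ Summable fun i => ⟪basis H i, T (basis H i)⟫_ℂ}

variable {H}

/-- The trace `∑ᵢ ⟨eᵢ, T eᵢ⟩`; meaningful for trace class operators. -/
def tr (T : H →L[ℂ] H) : ℂ := ∑' i, ⟪basis H i, T (basis H i)⟫_ℂ

variable (H)

/-- The states `𝒮(H)`: positive trace class operators of trace one. -/
def states : Set (H →L[ℂ] H) := {ρ | 0 ≤ ρ ∧ ρ ∈ traceClass H ∧ tr ρ = 1}

/-- The ultraweak topology of `ℒ(H)`: the coarsest topology that makes all the functionals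
`A ↦ tr (T A)`, with `T` trace class, continuous. -/
@[reducible] def ultraweak : TopologicalSpace (H →L[ℂ] H) :=
  TopologicalSpace.induced (fun A (T : traceClass H) => tr (T.1 * A)) inferInstance

end TraceClass

section Tensor

/-- The Hilbert space tensor product: the completion of the algebraic tensor product. -/
abbrev HTensor (H₁ : Type u) (H₂ : Type v) [NormedAddCommGroup H₁] [InnerProductSpace ℂ H₁]
    [NormedAddCommGroup H₂] [InnerProductSpace ℂ H₂] : Type (max u v) :=
  UniformSpace.Completion (H₁ ⊗[ℂ] H₂)

variable {H₁ : Type u} [NormedAddCommGroup H₁] [InnerProductSpace ℂ H₁]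
variable {H₂ : Type v} [NormedAddCommGroup H₂] [InnerProductSpace ℂ H₂]

/-- The tensor product `A ⊗ B` of bounded operators, acting on the Hilbert tensor product. -/
def opTensor (A : H₁ →L[ℂ] H₁) (B : H₂ →L[ℂ] H₂) : HTensor H₁ H₂ →L[ℂ] HTensor H₁ H₂ :=
  (TensorProduct.mapL A B).completion

/-- The bounded operator `φ ↦ φ ⊗ ψ`. -/
def tensorRight (ψ : H₂) : H₁ →L[ℂ] HTensor H₁ H₂ :=
  UniformSpace.Completion.toComplL ∘L (TensorProduct.mkL ℂ H₁ H₂).flip ψ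

/-- The bounded operator `ψ ↦ φ ⊗ ψ`. -/
def tensorLeft (φ : H₁) : H₂ →L[ℂ] HTensor H₁ H₂ :=
  UniformSpace.Completion.toComplL ∘L TensorProduct.mkL ℂ H₁ H₂ φ

variable [CompleteSpace H₁] [CompleteSpace H₂]

/-- The partial trace over the second factor, `tr_{H₂} : 𝒯(H₁ ⊗ H₂) → 𝒯(H₁)`: if `(fⱼ)` is the
basis of `H₂` and `Vⱼ φ = φ ⊗ fⱼ`, it is `∑ⱼ Vⱼ* ρ Vⱼ`, a norm convergent sum for trace
class `ρ`. -/
def ptraceSnd (ρ : HTensor H₁ H₂ →L[ℂ] HTensor H₁ H₂) : H₁ →L[ℂ] H₁ :=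
  ∑' j, (tensorRight (basis H₂ j)).adjoint ∘L ρ ∘L tensorRight (basis H₂ j)

/-- The partial trace over the first factor, `tr_{H₁} : 𝒯(H₁ ⊗ H₂) → 𝒯(H₂)`. -/
def ptraceFst (ρ : HTensor H₁ H₂ →L[ℂ] HTensor H₁ H₂) : H₂ →L[ℂ] H₂ :=
  ∑' i, (tensorLeft (basis H₁ i)).adjoint ∘L ρ ∘L tensorLeft (basis H₁ i)

end Tensor

section Channels

variable {K : Type u} [NormedAddCommGroup K] [InnerProductSpace ℂ K] [CompleteSpace K]
variable {H : Type v} [NormedAddCommGroup H] [InnerProductSpace ℂ H] [CompleteSpace H]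

/-- Complete positivity of a linear map `Φ : ℒ(K) → ℒ(H)`. -/
def IsCP (Φ : (K →L[ℂ] K) →ₗ[ℂ] (H →L[ℂ] H)) : Prop :=
  ∀ (n : ℕ) (a : Fin n → K →L[ℂ] K) (φ : Fin n → H),
    0 ≤ ∑ j, ∑ k, ⟪φ j, Φ (star (a j) * a k) (φ k)⟫_ℂ

/-- Normality of a linear map `Φ : ℒ(K) → ℒ(H)`: continuity for the ultraweak topologies. -/
def IsNormalMap (Φ : (K →L[ℂ] K) →ₗ[ℂ] (H →L[ℂ] H)) : Prop :=
  @Continuous _ _ (ultraweak K) (ultraweak H) Φ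

/-- A *-representation `ℒ(K) → ℒ(H)` (unital whenever it is a channel). -/
def IsStarRep (Φ : (K →L[ℂ] K) →ₗ[ℂ] (H →L[ℂ] H)) : Prop :=
  (∀ A B, Φ (A * B) = Φ A * Φ B) ∧ ∀ A, Φ (star A) = star (Φ A)

variable (K H)

/-- The channels `𝒞(K; H)`, in the Heisenberg picture: unital normal completely positive maps
`ℒ(K) → ℒ(H)`. -/
def channels : Set ((K →L[ℂ] K) →ₗ[ℂ] (H →L[ℂ] H)) :=
  {E | IsCP E ∧ IsNormalMap E ∧ E 1 = 1}

variable {K H}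

/-- A Schrödinger channel `𝒯(H) → 𝒯(K)`: the predual map of a channel in `𝒞(K; H)`. -/
def IsSchrodingerChannel (F : traceClass H →ₗ[ℂ] traceClass K) : Prop :=
  ∃ E ∈ channels K H, ∀ (T : traceClass H) (B : K →L[ℂ] K),
    tr ((F T).1 * B) = tr (T.1 * E B)

end Channels

section Measures

variable {Ω : Type u} [MeasurableSpace Ω]
variable {H : Type v} [NormedAddCommGroup H] [InnerProductSpace ℂ H] [CompleteSpace H]

/-- `M` is an operator measure: countably additive on the σ-algebra in the weak operator topology.
A set function is extended by `0` to the non-measurable sets, as for Mathlib's vector measures. -/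
def IsOperatorMeasure (M : Set Ω → H →L[ℂ] H) : Prop :=
  (∀ X, ¬ MeasurableSet X → M X = 0) ∧
  ∀ X : ℕ → Set Ω, (∀ n, MeasurableSet (X n)) → Pairwise (fun m n => Disjoint (X m) (X n)) →
    ∀ φ ψ : H, HasSum (fun n => ⟪φ, M (X n) ψ⟫_ℂ) ⟪φ, M (⋃ n, X n) ψ⟫_ℂ

/-- Sharpness of an observable: it is projection valued. -/
def IsSharp (M : Set Ω → H →L[ℂ] H) : Prop := ∀ X, MeasurableSet X → IsStarProjection (M X)

variable (Ω H)

/-- The observables `𝒪_Σ(H)`: normalized positive operator valued measures. -/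
def observables : Set (Set Ω → H →L[ℂ] H) :=
  {M | IsOperatorMeasure M ∧ (∀ X, 0 ≤ M X) ∧ M Set.univ = 1}

variable {Ω}

/-- The observables `𝒪_ν(H)`: normalized positive operator valued measures that are absolutely
continuous with respect to `ν`. -/
def observablesOn (ν : Measure Ω) : Set (Set Ω → H →L[ℂ] H) :=
  {M ∈ observables Ω H | ∀ X, MeasurableSet X → ν X = 0 → M X = 0}

variable {H}

/-- `M` has the marginals `M₁` and `M₂`. -/
def IsJointObservable {Ω' : Type w} [MeasurableSpace Ω'] (M : Set (Ω × Ω') → H →L[ℂ] H)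
    (M₁ : Set Ω → H →L[ℂ] H) (M₂ : Set Ω' → H →L[ℂ] H) : Prop :=
  (∀ X, MeasurableSet X → M (X ×ˢ Set.univ) = M₁ X) ∧
  (∀ Y, MeasurableSet Y → M (Set.univ ×ˢ Y) = M₂ Y)

variable (Ω H)
variable (K : Type w) [NormedAddCommGroup K] [InnerProductSpace ℂ K] [CompleteSpace K]

/-- The instruments `ℐ_Σ(K; H)`, as maps `(X, B) ↦ Γ X B`. -/
def instruments : Set (Set Ω → (K →L[ℂ] K) →ₗ[ℂ] (H →L[ℂ] H)) :=
  {Γ | (∀ B, IsOperatorMeasure fun X => Γ X B) ∧ (fun X => Γ X 1) ∈ observables Ω H ∧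
    (∀ X, IsCP (Γ X) ∧ IsNormalMap (Γ X)) ∧ Γ Set.univ ∈ channels K H}

variable {Ω}

/-- The instruments `ℐ_ν(K; H)`: those that are absolutely continuous with respect to `ν`. -/
def instrumentsOn (ν : Measure Ω) : Set (Set Ω → (K →L[ℂ] K) →ₗ[ℂ] (H →L[ℂ] H)) :=
  {Γ ∈ instruments Ω H K | ∀ X, MeasurableSet X → ν X = 0 → Γ X = 0}

variable {H K}

/-- `Γ` has the marginal observable `M` and the marginal channel `E`. -/
def IsJointInstrument (Γ : Set Ω → (K →L[ℂ] K) →ₗ[ℂ] (H →L[ℂ] H)) (M : Set Ω → H →L[ℂ] H)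
    (E : (K →L[ℂ] K) →ₗ[ℂ] (H →L[ℂ] H)) : Prop :=
  (∀ X, MeasurableSet X → Γ X 1 = M X) ∧ Γ Set.univ = E

end Measures

end QJoint

end

open QJoint

/-!
If `x` is an extreme point of a convex set `S` and `x = a + b = a' + b'` with `a + b'` and `a' + b`
in `S`, then `a = a'`, because `x` is the midpoint of `a + b'` and `a' + b`. Cutting two joint
observables along a set `Z`, with `a` and `a'` the parts in `Z` and `b` and `b'` the parts in the
complement, makes them agree on all rectangles as soon as one marginal is extremal. Instruments
are cut in the same way, along a pair `B`, `1 - B` of effects or along a measurable set and its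
complement.

Sharpness enters through the fact that `0 ≤ a ≤ p` and `0 ≤ b ≤ 1 - p` with a projection `p` imply
`a = p (a + b) = (a + b) p`.

If the partial trace `P` of `ρ ≥ 0` over the first factor is pure, each slice
`ψ ↦ ⟨φ ⊗ ψ, ρ (φ ⊗ ψ)⟩` is dominated by a multiple of `P`, hence proportional to `P`, and
polarization in `φ` shows that `ρ` is a product. A broadcasting channel therefore maps each pure
state `|φ⟩⟨φ|` to a product, and by duality the other tensor factor does not depend on `φ`.
-/

namespace QJoint

section Convexity

lemma eq_of_add_eq_of_mem_extremePoints {𝕜 E : Type*} [Field 𝕜] [LinearOrder 𝕜]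
    [IsStrictOrderedRing 𝕜] [AddCommGroup E] [Module 𝕜 E] {S : Set E} {x a b a' b' : E}
    (hx : x ∈ S.extremePoints 𝕜) (hab : a + b = x) (hab' : a' + b' = x) (h : a + b' ∈ S)
    (h' : a' + b ∈ S) : a = a' := by
  have hmid : (1 / 2 : 𝕜) • (a + b') + (1 / 2 : 𝕜) • (a' + b) = x := by
    rw [← smul_add, add_add_add_comm, add_comm b', ← add_add_add_comm, hab, hab', ← two_smul 𝕜 x,
      smul_smul, one_div_mul_cancel two_ne_zero, one_smul]
  have hab'x : a + b' = x :=
    hx.2 h h' ⟨1 / 2, 1 / 2, by positivity, by positivity, add_halves 1, hmid⟩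
  exact add_right_cancel (hab'x.trans hab'.symm)

lemma mem_extremePoints_of_mapsTo {𝕜 E F : Type*} [Semiring 𝕜] [PartialOrder 𝕜]
    [AddCommMonoid E] [Module 𝕜 E] [AddCommMonoid F] [Module 𝕜 F] (π : E →ₗ[𝕜] F) {S : Set E}
    {T : Set F} {x : E} (hπ : Set.MapsTo π S T) (hx : x ∈ S) (hπx : π x ∈ T.extremePoints 𝕜)
    (hfiber : ∀ y ∈ S, π y = π x → y = x) : x ∈ S.extremePoints 𝕜 := by
  refine ⟨hx, fun y hy z hz hxyz => hfiber y hy (hπx.2 (hπ hy) (hπ hz) ?_)⟩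
  obtain ⟨s, t, hs, ht, hst, rfl⟩ := hxyz
  exact ⟨s, t, hs, ht, hst, by simp⟩

end Convexity

section PositiveOperators

variable {H : Type*} [NormedAddCommGroup H] [InnerProductSpace ℂ H]

lemma nonneg_iff_forall_inner_nonneg {A : H →L[ℂ] H} : 0 ≤ A ↔ ∀ x, 0 ≤ ⟪x, A x⟫_ℂ := by
  rw [ContinuousLinearMap.nonneg_iff_isPositive]
  refine ⟨fun h => h.inner_nonneg_right, fun h => A.isPositive_iff_complex.2 fun x => ?_⟩
  have hx : 0 ≤ ⟪A x, x⟫_ℂ := by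
    rw [← inner_conj_symm, ← RCLike.star_def, star_nonneg_iff]
    exact h x
  exact ⟨Complex.conj_eq_iff_re.1 (Complex.conj_eq_iff_im.2 (Complex.nonneg_iff.1 hx).2.symm),
    (Complex.nonneg_iff.1 hx).1⟩

variable [CompleteSpace H]

lemma le_iff_forall_inner_le {A B : H →L[ℂ] H} : A ≤ B ↔ ∀ x, ⟪x, A x⟫_ℂ ≤ ⟪x, B x⟫_ℂ := by
  rw [← sub_nonneg, nonneg_iff_forall_inner_nonneg]
  simp only [sub_apply, inner_sub_right, sub_nonneg]

lemma inner_apply_eq_inner_sqrt {A : H →L[ℂ] H} (hA : 0 ≤ A) (x y : H) :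
    ⟪x, A y⟫_ℂ = ⟪CFC.sqrt A x, CFC.sqrt A y⟫_ℂ := by
  have hsqrt : (CFC.sqrt A).IsPositive :=
    (ContinuousLinearMap.nonneg_iff_isPositive _).1 (CFC.sqrt_nonneg A)
  rw [hsqrt.inner_left_eq_inner_right, ← mul_apply_eq_comp, CFC.sqrt_mul_sqrt_self A]

lemma apply_eq_zero_of_inner_eq_zero {A : H →L[ℂ] H} (hA : 0 ≤ A) {x : H}
    (hx : ⟪x, A x⟫_ℂ = 0) : A x = 0 := by
  rw [inner_apply_eq_inner_sqrt hA, inner_self_eq_zero] at hx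
  rw [← CFC.sqrt_mul_sqrt_self A, mul_apply_eq_comp, hx, map_zero]

end PositiveOperators

lemma eq_mul_add_of_le_of_le_one_sub {A : Type*} [CStarAlgebra A] [PartialOrder A]
    [StarOrderedRing A] {a b p : A} (hp : IsStarProjection p) (ha : 0 ≤ a) (hb : 0 ≤ b)
    (hap : a ≤ p) (hbp : b ≤ 1 - p) : a = p * (a + b) ∧ a = (a + b) * p := by
  obtain ⟨hap₁, hap₂⟩ := hp.mul_right_and_mul_left_of_nonneg_of_le ha hap
  obtain ⟨hbp₁, hbp₂⟩ := hp.one_sub.mul_right_and_mul_left_of_nonneg_of_le hb hbp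
  rw [mul_sub, mul_one, sub_eq_self] at hbp₁
  rw [sub_mul, one_mul, sub_eq_self] at hbp₂
  rw [mul_add, add_mul, hap₁, hap₂, hbp₁, hbp₂, add_zero]
  exact ⟨rfl, rfl⟩

lemma mul_eq_sqrt_mul_mul_sqrt {A : Type*} [CStarAlgebra A] [PartialOrder A] [StarOrderedRing A]
    {a b : A} (ha : 0 ≤ a) (hab : Commute a b) : a * b = CFC.sqrt a * b * CFC.sqrt a := by
  have hcomm : Commute (CFC.sqrt a) b := hab.cfcₙ_nnreal _
  rw [mul_assoc, ← hcomm.eq, ← mul_assoc, CFC.sqrt_mul_sqrt_self a]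

section Observables

variable {Ω Ω' Θ : Type*} [MeasurableSpace Ω] [MeasurableSpace Ω']
variable {H : Type*} [NormedAddCommGroup H] [InnerProductSpace ℂ H]

namespace IsOperatorMeasure

variable {M N : Set Ω → H →L[ℂ] H}

/-- The complex measure `X ↦ ⟨φ, M(X) ψ⟩`, through which Mathlib's theory of vector measures
applies to weakly countably additive operator measures. -/
noncomputable def matrixElement (hM : IsOperatorMeasure M) (φ ψ : H) : VectorMeasure Ω ℂ where
  measureOf' X := ⟪φ, M X ψ⟫_ℂ
  empty' := (summable_const_iff _).1 (hM.2 (fun _ => ∅) (fun _ => MeasurableSet.empty)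
    (fun _ _ _ => disjoint_bot_left) φ ψ).summable
  not_measurable' X hX := by simp only [hM.1 X hX, zero_apply, inner_zero_right]
  m_iUnion' f hf hd := hM.2 f hf hd φ ψ

lemma apply_empty (hM : IsOperatorMeasure M) : M ∅ = 0 :=
  ContinuousLinearMap.ext fun ψ => ext_inner_left ℂ fun φ =>
    (hM.matrixElement φ ψ).empty.trans (inner_zero_right φ).symm

lemma apply_union (hM : IsOperatorMeasure M) {X Y : Set Ω} (hX : MeasurableSet X)
    (hY : MeasurableSet Y) (h : Disjoint X Y) : M (X ∪ Y) = M X + M Y := by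
  refine ContinuousLinearMap.ext fun ψ => ext_inner_left ℂ fun φ => ?_
  rw [add_apply, inner_add_right]
  exact (hM.matrixElement φ ψ).of_union h hX hY

lemma apply_inter_add_inter_compl (hM : IsOperatorMeasure M) {X Y : Set Ω}
    (hX : MeasurableSet X) (hY : MeasurableSet Y) : M (X ∩ Y) + M (X ∩ Yᶜ) = M X := by
  rw [← hM.apply_union (hX.inter hY) (hX.inter hY.compl)
    (disjoint_compl_right.mono Set.inter_subset_right Set.inter_subset_right),
    Set.inter_union_compl]

lemma apply_add_apply_compl (hM : IsOperatorMeasure M) {X : Set Ω} (hX : MeasurableSet X) :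
    M X + M Xᶜ = M Set.univ := by
  rw [← hM.apply_union hX hX.compl disjoint_compl_right, Set.union_compl_self]

lemma add (hM : IsOperatorMeasure M) (hN : IsOperatorMeasure N) : IsOperatorMeasure (M + N) := by
  refine ⟨fun X hX => by rw [Pi.add_apply, hM.1 X hX, hN.1 X hX, add_zero], fun X hX hd φ ψ => ?_⟩
  simpa only [Pi.add_apply, add_apply, inner_add_right] using
    (hM.2 X hX hd φ ψ).add (hN.2 X hX hd φ ψ)

lemma ext_prod {M N : Set (Ω × Ω') → H →L[ℂ] H} (hM : IsOperatorMeasure M)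
    (hN : IsOperatorMeasure N)
    (h : ∀ X Y, MeasurableSet X → MeasurableSet Y → M (X ×ˢ Y) = N (X ×ˢ Y)) : M = N := by
  have hrect : ∀ φ ψ X Y, MeasurableSet X → MeasurableSet Y →
      hM.matrixElement φ ψ (X ×ˢ Y) = hN.matrixElement φ ψ (X ×ˢ Y) := fun φ ψ X Y hX hY =>
    congrArg (fun A : H →L[ℂ] H => ⟪φ, A ψ⟫_ℂ) (h X Y hX hY)
  have helem : ∀ φ ψ, hM.matrixElement φ ψ = hN.matrixElement φ ψ := by
    intro φ ψ
    refine VectorMeasure.ext_of_generateFrom _ ?_ generateFrom_prod.symm isPiSystem_prod ?_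
    · rintro _ ⟨X, hX, Y, hY, rfl⟩
      exact hrect φ ψ X Y hX hY
    · simpa only [Set.univ_prod_univ] using hrect φ ψ Set.univ Set.univ .univ .univ
  ext Z : 1
  exact ContinuousLinearMap.ext fun ψ => ext_inner_left ℂ fun φ =>
    DFunLike.congr_fun (helem φ ψ) Z

end IsOperatorMeasure

open Classical in
/-- The image under `f` of the restriction of a set function to `Z`, as a linear map. For
`Z = Set.univ` and `f` a coordinate projection it is the marginal of a set function on a product.
As for `IsOperatorMeasure`, the value at a non-measurable set is `0`. -/
noncomputable def restrictMap {V : Type*} [AddCommGroup V] [Module ℝ V] (f : Θ → Ω) (Z : Set Θ) :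
    (Set Θ → V) →ₗ[ℝ] (Set Ω → V) :=
  LinearMap.pi fun X => if MeasurableSet X then LinearMap.proj (f ⁻¹' X ∩ Z) else 0

section RestrictMap

variable {V : Type*} [AddCommGroup V] [Module ℝ V] {f : Θ → Ω} {Z : Set Θ} {M : Set Θ → V}
  {X : Set Ω}

lemma restrictMap_apply (hX : MeasurableSet X) : restrictMap f Z M X = M (f ⁻¹' X ∩ Z) := by
  simp only [restrictMap, LinearMap.pi_apply, if_pos hX, LinearMap.proj_apply]

lemma restrictMap_of_not_measurableSet (hX : ¬ MeasurableSet X) : restrictMap f Z M X = 0 := by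
  simp only [restrictMap, LinearMap.pi_apply, if_neg hX, LinearMap.zero_apply]

lemma restrictMap_univ_apply (hX : MeasurableSet X) :
    restrictMap f Set.univ M X = M (f ⁻¹' X) := by
  rw [restrictMap_apply hX, Set.inter_univ]

end RestrictMap

lemma restrictMap_univ_eq_iff {f : Θ → Ω} {M : Set Θ → H →L[ℂ] H} {N : Set Ω → H →L[ℂ] H}
    (hN : IsOperatorMeasure N) :
    restrictMap f Set.univ M = N ↔ ∀ X, MeasurableSet X → M (f ⁻¹' X) = N X := by
  refine ⟨fun h X hX => by rw [← h, restrictMap_univ_apply hX], fun h => funext fun X => ?_⟩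
  by_cases hX : MeasurableSet X
  · rw [restrictMap_univ_apply hX, h X hX]
  · rw [restrictMap_of_not_measurableSet hX, hN.1 X hX]

lemma restrictMap_nonneg {f : Θ → Ω} {Z : Set Θ} {M : Set Θ → H →L[ℂ] H} (hM : ∀ X, 0 ≤ M X)
    (X : Set Ω) : 0 ≤ restrictMap f Z M X := by
  by_cases hX : MeasurableSet X
  · rw [restrictMap_apply hX]
    exact hM _
  · rw [restrictMap_of_not_measurableSet hX]

variable [MeasurableSpace Θ]

namespace IsOperatorMeasure

variable {M : Set Θ → H →L[ℂ] H} {f : Θ → Ω} {Z : Set Θ}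

lemma restrictMap (hM : IsOperatorMeasure M) (hf : Measurable f) (hZ : MeasurableSet Z) :
    IsOperatorMeasure (restrictMap f Z M) := by
  refine ⟨fun X hX => restrictMap_of_not_measurableSet hX, fun X hX hd φ ψ => ?_⟩
  simp only [restrictMap_apply (hX _), restrictMap_apply (MeasurableSet.iUnion hX),
    Set.preimage_iUnion, Set.iUnion_inter]
  exact hM.2 _ (fun n => (hf (hX n)).inter hZ)
    (fun m n hmn => ((hd hmn).preimage f).mono Set.inter_subset_left Set.inter_subset_left) φ ψ

lemma restrictMap_add_restrictMap_compl (hM : IsOperatorMeasure M) (hf : Measurable f)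
    (hZ : MeasurableSet Z) :
    QJoint.restrictMap f Z M + QJoint.restrictMap f Zᶜ M = QJoint.restrictMap f Set.univ M := by
  ext X : 1
  by_cases hX : MeasurableSet X
  · rw [Pi.add_apply, restrictMap_apply hX, restrictMap_apply hX, restrictMap_univ_apply hX,
      hM.apply_inter_add_inter_compl (hf hX) hZ]
  · simp only [Pi.add_apply, restrictMap_of_not_measurableSet hX, add_zero]

end IsOperatorMeasure

lemma observables_eq_observablesOn_count : observables Ω H = observablesOn H Measure.count := by
  refine (Set.sep_eq_self_iff_mem_true.2 fun M hM X _ hX => ?_).symm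
  rw [Measure.count_eq_zero_iff.1 hX, hM.1.apply_empty]

lemma quasiMeasurePreserving_count {f : Θ → Ω} (hf : Measurable f) :
    Measure.QuasiMeasurePreserving f Measure.count Measure.count :=
  ⟨hf, fun X hX => by rw [Measure.count_eq_zero_iff.1 hX, measure_empty]⟩

lemma restrictMap_univ_mem_observablesOn {f : Θ → Ω} {M : Set Θ → H →L[ℂ] H} {ν : Measure Ω}
    {μ : Measure Θ} (hM : M ∈ observablesOn H μ) (hf : Measure.QuasiMeasurePreserving f μ ν) :
    restrictMap f Set.univ M ∈ observablesOn H ν := by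
  refine ⟨⟨hM.1.1.restrictMap hf.measurable .univ, restrictMap_nonneg hM.1.2.1, ?_⟩,
    fun X hX hνX => ?_⟩
  · rw [restrictMap_univ_apply .univ, Set.preimage_univ, hM.1.2.2]
  · rw [restrictMap_univ_apply hX]
    exact hM.2 _ (hf.measurable hX) (hf.preimage_null hνX)

lemma isJointObservable_iff_restrictMap {M : Set (Ω × Ω') → H →L[ℂ] H} {M₁ : Set Ω → H →L[ℂ] H}
    {M₂ : Set Ω' → H →L[ℂ] H} (hM₁ : IsOperatorMeasure M₁) (hM₂ : IsOperatorMeasure M₂) :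
    IsJointObservable M M₁ M₂ ↔
      restrictMap Prod.fst Set.univ M = M₁ ∧ restrictMap Prod.snd Set.univ M = M₂ := by
  simp only [IsJointObservable, restrictMap_univ_eq_iff hM₁, restrictMap_univ_eq_iff hM₂,
    Set.prod_univ, Set.univ_prod]

variable [CompleteSpace H]

lemma add_mem_observablesOn {M A B : Set Ω → H →L[ℂ] H} {ν : Measure Ω}
    (hM : M ∈ observablesOn H ν) (hA : IsOperatorMeasure A) (hB : IsOperatorMeasure B)
    (hA₀ : ∀ X, 0 ≤ A X) (hB₀ : ∀ X, 0 ≤ B X) (hAM : A ≤ M) (hBM : B ≤ M)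
    (hAB : A Set.univ + B Set.univ = 1) : A + B ∈ observablesOn H ν := by
  refine ⟨⟨hA.add hB, fun X => add_nonneg (hA₀ X) (hB₀ X), hAB⟩, fun X hX hνX => ?_⟩
  have hMX : M X = 0 := hM.2 X hX hνX
  rw [Pi.add_apply, ((hAM X).trans_eq hMX).antisymm (hA₀ X),
    ((hBM X).trans_eq hMX).antisymm (hB₀ X), add_zero]

/-- If `M` and `N` have the same extremal image `M₁` under `f` and agree at `Z`, then restricting
`M` to `Z` and `N` to `Zᶜ`, or conversely, yields two observables with average `M₁`. -/
lemma restrictMap_eq_of_mem_extremePoints {M N : Set Θ → H →L[ℂ] H} {ν : Measure Ω}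
    {f : Θ → Ω} {Z : Set Θ} (hM : M ∈ observables Θ H) (hN : N ∈ observables Θ H)
    (hf : Measurable f) (hZ : MeasurableSet Z)
    (hext : restrictMap f Set.univ M ∈ (observablesOn H ν).extremePoints ℝ)
    (hMN : restrictMap f Set.univ N = restrictMap f Set.univ M) (hMNZ : M Z = N Z) :
    restrictMap f Z M = restrictMap f Z N := by
  have hmixed : ∀ {M N : Set Θ → H →L[ℂ] H}, M ∈ observables Θ H → N ∈ observables Θ H →
      restrictMap f Set.univ N = restrictMap f Set.univ M →
      restrictMap f Set.univ M ∈ observablesOn H ν → M Z = N Z →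
      restrictMap f Z M + restrictMap f Zᶜ N ∈ observablesOn H ν := by
    intro M N hM hN hMN hMν hMNZ
    refine add_mem_observablesOn hMν (hM.1.restrictMap hf hZ) (hN.1.restrictMap hf hZ.compl)
      (restrictMap_nonneg hM.2.1) (restrictMap_nonneg hN.2.1) ?_ ?_ ?_
    · rw [← hM.1.restrictMap_add_restrictMap_compl hf hZ]
      exact le_add_of_nonneg_right (restrictMap_nonneg hM.2.1)
    · rw [← hMN, ← hN.1.restrictMap_add_restrictMap_compl hf hZ]
      exact le_add_of_nonneg_left (restrictMap_nonneg hN.2.1)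
    · simp only [restrictMap_apply MeasurableSet.univ, Set.preimage_univ, Set.univ_inter]
      rw [hMNZ, hN.1.apply_add_apply_compl hZ, hN.2.2]
  exact eq_of_add_eq_of_mem_extremePoints hext (hM.1.restrictMap_add_restrictMap_compl hf hZ)
    ((hN.1.restrictMap_add_restrictMap_compl hf hZ).trans hMN)
    (hmixed hM hN hMN hext.1 hMNZ) (hmixed hN hM hMN.symm (hMN ▸ hext.1) hMNZ.symm)

lemma apply_inter_of_isStarProjection {M : Set Θ → H →L[ℂ] H} (hM : M ∈ observables Θ H)
    {S Z : Set Θ} (hS : MeasurableSet S) (hZ : MeasurableSet Z) (hP : IsStarProjection (M S)) :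
    M (S ∩ Z) = M S * M Z ∧ M (S ∩ Z) = M Z * M S := by
  have hmono : ∀ {S}, MeasurableSet S → M (S ∩ Z) ≤ M S := fun {S} hS => by
    rw [← hM.1.apply_inter_add_inter_compl hS hZ]
    exact le_add_of_nonneg_right (hM.2.1 _)
  have hcompl : M Sᶜ = 1 - M S :=
    eq_sub_of_add_eq' ((hM.1.apply_add_apply_compl hS).trans hM.2.2)
  have hsum : M (S ∩ Z) + M (Sᶜ ∩ Z) = M Z := by
    rw [Set.inter_comm S, Set.inter_comm Sᶜ, hM.1.apply_inter_add_inter_compl hZ hS]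
  rw [← hsum]
  exact eq_mul_add_of_le_of_le_one_sub hP (hM.2.1 _) (hM.2.1 _) (hmono hS)
    (hcompl ▸ hmono hS.compl)

namespace IsJointObservable

variable {M N : Set (Ω × Ω') → H →L[ℂ] H} {M₁ : Set Ω → H →L[ℂ] H} {M₂ : Set Ω' → H →L[ℂ] H}
  {ν : Measure Ω} {ν' : Measure Ω'} {μ : Measure (Ω × Ω')}

lemma eq_of_mem_extremePoints (hM : M ∈ observables (Ω × Ω') H)
    (hN : N ∈ observables (Ω × Ω') H) (hM₁ : IsOperatorMeasure M₁) (hM₂ : IsOperatorMeasure M₂)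
    (hMj : IsJointObservable M M₁ M₂) (hNj : IsJointObservable N M₁ M₂)
    (hext : M₁ ∈ (observablesOn H ν).extremePoints ℝ ∨
      M₂ ∈ (observablesOn H ν').extremePoints ℝ) : M = N := by
  obtain ⟨hMfst, hMsnd⟩ := (isJointObservable_iff_restrictMap hM₁ hM₂).1 hMj
  obtain ⟨hNfst, hNsnd⟩ := (isJointObservable_iff_restrictMap hM₁ hM₂).1 hNj
  refine hM.1.ext_prod hN.1 fun X Y hX hY => ?_
  rw [Set.prod_eq]
  rcases hext with hext | hext
  · have hYfiber : M (Prod.snd ⁻¹' Y) = N (Prod.snd ⁻¹' Y) := by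
      rw [← Set.univ_prod, hMj.2 Y hY, hNj.2 Y hY]
    have h := restrictMap_eq_of_mem_extremePoints hM hN measurable_fst (measurable_snd hY)
      (hMfst.symm ▸ hext) (hNfst.trans hMfst.symm) hYfiber
    simpa only [restrictMap_apply hX] using congrFun h X
  · have hXfiber : M (Prod.fst ⁻¹' X) = N (Prod.fst ⁻¹' X) := by
      rw [← Set.prod_univ, hMj.1 X hX, hNj.1 X hX]
    have h := restrictMap_eq_of_mem_extremePoints hM hN measurable_snd (measurable_fst hX)
      (hMsnd.symm ▸ hext) (hNsnd.trans hMsnd.symm) hXfiber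
    rw [Set.inter_comm]
    simpa only [restrictMap_apply hY] using congrFun h Y

lemma mem_extremePoints (hfst : Measure.QuasiMeasurePreserving Prod.fst μ ν)
    (hsnd : Measure.QuasiMeasurePreserving Prod.snd μ ν') (hM : M ∈ observablesOn H μ)
    (hM₁ : M₁ ∈ (observablesOn H ν).extremePoints ℝ)
    (hM₂ : M₂ ∈ (observablesOn H ν').extremePoints ℝ) (hMj : IsJointObservable M M₁ M₂) :
    M ∈ (observablesOn H μ).extremePoints ℝ := by
  have hiff := fun N : Set (Ω × Ω') → H →L[ℂ] H =>
    isJointObservable_iff_restrictMap (M := N) hM₁.1.1.1 hM₂.1.1.1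
  obtain ⟨hMfst, hMsnd⟩ := (hiff M).1 hMj
  let marginals : (Set (Ω × Ω') → H →L[ℂ] H) →ₗ[ℝ] (Set Ω → H →L[ℂ] H) × (Set Ω' → H →L[ℂ] H) :=
    (restrictMap Prod.fst Set.univ).prod (restrictMap Prod.snd Set.univ)
  have hmarginals : marginals M = (M₁, M₂) := Prod.ext hMfst hMsnd
  refine mem_extremePoints_of_mapsTo marginals (T := observablesOn H ν ×ˢ observablesOn H ν')
    (fun N hN => ⟨restrictMap_univ_mem_observablesOn hN hfst,
      restrictMap_univ_mem_observablesOn hN hsnd⟩) hM ?_ fun N hN hNM => ?_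
  · rw [hmarginals, extremePoints_prod]
    exact ⟨hM₁, hM₂⟩
  · obtain ⟨hNfst, hNsnd⟩ := Prod.ext_iff.1 hNM
    exact eq_of_mem_extremePoints (ν' := ν') hN.1 hM.1 hM₁.1.1.1 hM₂.1.1.1
      ((hiff N).2 ⟨hNfst.trans hMfst, hNsnd.trans hMsnd⟩) hMj (.inl hM₁)

lemma apply_prod_of_isSharp (hM : M ∈ observables (Ω × Ω') H) (hMj : IsJointObservable M M₁ M₂)
    (hsharp : IsSharp M₁ ∨ IsSharp M₂) {X : Set Ω} {Y : Set Ω'} (hX : MeasurableSet X)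
    (hY : MeasurableSet Y) : M (X ×ˢ Y) = M₁ X * M₂ Y ∧ M (X ×ˢ Y) = M₂ Y * M₁ X := by
  rw [Set.prod_eq, ← hMj.1 X hX, ← hMj.2 Y hY, Set.prod_univ, Set.univ_prod]
  rcases hsharp with hsharp | hsharp
  · refine apply_inter_of_isStarProjection hM (measurable_fst hX) (measurable_snd hY) ?_
    rw [← Set.prod_univ, hMj.1 X hX]
    exact hsharp X hX
  · rw [Set.inter_comm]
    refine (apply_inter_of_isStarProjection hM (measurable_snd hY) (measurable_fst hX) ?_).symm
    rw [← Set.univ_prod, hMj.2 Y hY]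
    exact hsharp Y hY

lemma commute_of_isSharp (hM : M ∈ observables (Ω × Ω') H) (hMj : IsJointObservable M M₁ M₂)
    (hsharp : IsSharp M₁ ∨ IsSharp M₂) {X : Set Ω} {Y : Set Ω'} (hX : MeasurableSet X)
    (hY : MeasurableSet Y) : Commute (M₁ X) (M₂ Y) :=
  (apply_prod_of_isSharp hM hMj hsharp hX hY).1.symm.trans
    (apply_prod_of_isSharp hM hMj hsharp hX hY).2

lemma eq_of_isSharp (hM : M ∈ observables (Ω × Ω') H) (hN : N ∈ observables (Ω × Ω') H)
    (hMj : IsJointObservable M M₁ M₂) (hNj : IsJointObservable N M₁ M₂)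
    (hsharp : IsSharp M₁ ∨ IsSharp M₂) : M = N :=
  hM.1.ext_prod hN.1 fun _ _ hX hY => (apply_prod_of_isSharp hM hMj hsharp hX hY).1.trans
    (apply_prod_of_isSharp hN hNj hsharp hX hY).1.symm

end IsJointObservable

lemma isJointObservable_iff_apply_prod {M : Set (Ω × Ω') → H →L[ℂ] H} {M₁ : Set Ω → H →L[ℂ] H}
    {M₂ : Set Ω' → H →L[ℂ] H} (hM : M ∈ observables (Ω × Ω') H) (hM₁ : M₁ Set.univ = 1)
    (hM₂ : M₂ Set.univ = 1) (hsharp : IsSharp M₁ ∨ IsSharp M₂) : IsJointObservable M M₁ M₂ ↔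
      ∀ X Y, MeasurableSet X → MeasurableSet Y → M (X ×ˢ Y) = M₁ X * M₂ Y :=
  ⟨fun hMj _ _ hX hY => (hMj.apply_prod_of_isSharp hM hsharp hX hY).1, fun h =>
    ⟨fun X hX => by rw [h X _ hX .univ, hM₂, mul_one],
      fun Y hY => by rw [h _ Y .univ hY, hM₁, one_mul]⟩⟩

end Observables

section HilbertBasis

variable {𝕜 E F ι κ : Type*} [RCLike 𝕜] [NormedAddCommGroup E] [InnerProductSpace 𝕜 E]
  [NormedAddCommGroup F] [InnerProductSpace 𝕜 F]

lemma hasSum_norm_inner_sq (b : HilbertBasis ι 𝕜 E) (x : E) :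
    HasSum (fun i => ‖⟪b i, x⟫_𝕜‖ ^ 2) (‖x‖ ^ 2) := by
  rw [← RCLike.hasSum_ofReal 𝕜]
  convert b.hasSum_inner_mul_inner x x using 2 with i
  · rw [← inner_conj_symm x, RCLike.conj_mul, RCLike.ofReal_pow]
  · rw [inner_self_eq_norm_sq_to_K, RCLike.ofReal_pow]

lemma summable_norm_sq_adjoint [CompleteSpace E] [CompleteSpace F] (b : HilbertBasis ι 𝕜 E)
    (c : HilbertBasis κ 𝕜 F) {A : E →L[𝕜] F} (hA : Summable fun i => ‖A (b i)‖ ^ 2) :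
    Summable fun j => ‖A.adjoint (c j)‖ ^ 2 := by
  have hentries : Summable fun q : ι × κ => ‖⟪c q.2, A (b q.1)⟫_𝕜‖ ^ 2 := by
    refine (summable_prod_of_nonneg fun q => sq_nonneg _).2
      ⟨fun i => (hasSum_norm_inner_sq c (A (b i))).summable, ?_⟩
    simpa only [(hasSum_norm_inner_sq c _).tsum_eq] using hA
  have hrows := ((summable_prod_of_nonneg fun q => sq_nonneg _).1 hentries.prod_symm).2
  refine hrows.congr fun j => ?_
  rw [← (hasSum_norm_inner_sq b _).tsum_eq]
  refine tsum_congr fun i => ?_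
  rw [ContinuousLinearMap.adjoint_inner_right, norm_inner_symm]
  rfl

end HilbertBasis

section TraceClass

variable {H : Type*} [NormedAddCommGroup H] [InnerProductSpace ℂ H] [CompleteSpace H]

lemma norm_sqrt_apply_sq {T : H →L[ℂ] H} (hT : 0 ≤ T) (x : H) :
    ((‖CFC.sqrt T x‖ ^ 2 : ℝ) : ℂ) = ⟪x, T x⟫_ℂ := by
  rw [inner_apply_eq_inner_sqrt hT, inner_self_eq_norm_sq_to_K, Complex.ofReal_pow]
  rfl

lemma summable_inner_mul_of_nonneg {T : H →L[ℂ] H} (hT : 0 ≤ T)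
    (hs : Summable fun i => ⟪basis H i, T (basis H i)⟫_ℂ) (A : H →L[ℂ] H) :
    Summable fun i => ⟪basis H i, (T * A) (basis H i)⟫_ℂ := by
  set R := CFC.sqrt T
  have hR : Summable fun i => ‖R (basis H i)‖ ^ 2 :=
    Complex.summable_ofReal.1 (hs.congr fun i => (norm_sqrt_apply_sq hT _).symm)
  have hAR : Summable fun i => ‖(star A * R) (basis H i)‖ ^ 2 := by
    refine Summable.of_nonneg_of_le (fun i => sq_nonneg _) (fun i => ?_)
      (hR.mul_left (‖star A‖ ^ 2))
    rw [← mul_pow, mul_apply_eq_comp]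
    exact pow_le_pow_left₀ (norm_nonneg _) ((star A).le_opNorm _) 2
  have hRA : Summable fun i => ‖R (A (basis H i))‖ ^ 2 := by
    have hadj : (star A * R).adjoint = R * A := by
      rw [← ContinuousLinearMap.star_eq_adjoint, star_mul, star_star,
        (CFC.sqrt_nonneg T).isSelfAdjoint.star_eq]
    simpa only [hadj, mul_apply_eq_comp] using
      summable_norm_sq_adjoint (basis H) (basis H) hAR
  refine Summable.of_norm_bounded (hR.add hRA) fun i => ?_
  rw [mul_apply_eq_comp, inner_apply_eq_inner_sqrt hT]
  refine (norm_inner_le_norm _ _).trans ?_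
  nlinarith [two_mul_le_add_sq ‖R (basis H i)‖ ‖R (A (basis H i))‖,
    mul_nonneg (norm_nonneg (R (basis H i))) (norm_nonneg (R (A (basis H i))))]

lemma summable_inner_mul {T : H →L[ℂ] H} (hT : T ∈ traceClass H) (A : H →L[ℂ] H) :
    Summable fun i => ⟪basis H i, (T * A) (basis H i)⟫_ℂ := by
  induction hT using Submodule.span_induction with
  | mem T hT => exact summable_inner_mul_of_nonneg hT.1 hT.2 A
  | zero => simpa only [zero_mul, zero_apply, inner_zero_right] using summable_zero
  | add S T _ _ hS hT => simpa only [add_mul, add_apply, inner_add_right] using hS.add hT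
  | smul c T _ hT =>
    simpa only [smul_mul_assoc, smul_apply, inner_smul_right] using hT.mul_left c

lemma summable_inner_of_mem_traceClass {T : H →L[ℂ] H} (hT : T ∈ traceClass H) :
    Summable fun i => ⟪basis H i, T (basis H i)⟫_ℂ := by
  simpa only [mul_one] using summable_inner_mul hT 1

lemma tr_mul_add {T : H →L[ℂ] H} (hT : T ∈ traceClass H) (A B : H →L[ℂ] H) :
    tr (T * (A + B)) = tr (T * A) + tr (T * B) := by
  simp only [tr, mul_add, add_apply, inner_add_right]
  exact (summable_inner_mul hT A).tsum_add (summable_inner_mul hT B)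

end TraceClass

section CompletelyPositive

variable {K : Type*} [NormedAddCommGroup K] [InnerProductSpace ℂ K] [CompleteSpace K]
variable {H : Type*} [NormedAddCommGroup H] [InnerProductSpace ℂ H]
variable {Φ Ψ : (K →L[ℂ] K) →ₗ[ℂ] (H →L[ℂ] H)}

namespace IsCP

lemma add (hΦ : IsCP Φ) (hΨ : IsCP Ψ) : IsCP (Φ + Ψ) := by
  intro n a φ
  simpa only [LinearMap.add_apply, add_apply, inner_add_right, Finset.sum_add_distrib] using
    add_nonneg (hΦ n a φ) (hΨ n a φ)

lemma nonneg (hΦ : IsCP Φ) {B : K →L[ℂ] K} (hB : 0 ≤ B) : 0 ≤ Φ B := by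
  refine nonneg_iff_forall_inner_nonneg.2 fun x => ?_
  simpa only [Finset.univ_unique, Finset.sum_singleton,
    (CFC.sqrt_nonneg B).isSelfAdjoint.star_eq, CFC.sqrt_mul_sqrt_self B hB] using
    hΦ 1 (fun _ => CFC.sqrt B) (fun _ => x)

variable [CompleteSpace H]

lemma monotone (hΦ : IsCP Φ) : Monotone Φ := fun A B h => by
  rw [← sub_nonneg, ← map_sub]
  exact hΦ.nonneg (sub_nonneg.2 h)

lemma map_star (hΦ : IsCP Φ) (B : K →L[ℂ] K) : Φ (star B) = star (Φ B) :=
  StarHomClass.map_star (PositiveLinearMap.mk₀ Φ fun _ h => hΦ.nonneg h) B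

/-- The quadratic form of complete positivity is that of a positive block operator, hence its
null vectors are in the kernel of that operator. -/
lemma sum_apply_eq_zero (hΦ : IsCP Φ) {n : ℕ} (a : Fin n → K →L[ℂ] K) (φ : Fin n → H)
    (h : ∑ j, ∑ k, ⟪φ j, Φ (star (a j) * a k) (φ k)⟫_ℂ = 0) (j : Fin n) :
    ∑ k, Φ (star (a j) * a k) (φ k) = 0 := by
  let block : PiLp 2 (fun _ : Fin n => H) →L[ℂ] PiLp 2 (fun _ : Fin n => H) :=
    (PiLp.continuousLinearEquiv 2 ℂ fun _ : Fin n => H).symm ∘L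
      ContinuousLinearMap.pi fun j => ∑ k, Φ (star (a j) * a k) ∘L PiLp.proj 2 _ k
  have happly : ∀ x j, block x j = ∑ k, Φ (star (a j) * a k) (x k) := fun x j => by
    simp [block]
  have hform : ∀ x, ⟪x, block x⟫_ℂ = ∑ j, ∑ k, ⟪x j, Φ (star (a j) * a k) (x k)⟫_ℂ := fun x => by
    simp only [PiLp.inner_apply, happly, inner_sum]
  have hblock : 0 ≤ block := nonneg_iff_forall_inner_nonneg.2 fun x => by
    rw [hform]
    exact hΦ n a x
  have hzero := apply_eq_zero_of_inner_eq_zero hblock (x := WithLp.toLp 2 φ) ((hform _).trans h)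
  exact (happly _ j).symm.trans (congrArg (fun x => x j) hzero)

/-- With `E = Φ + Ψ`, the vector `(-E(b) ψ, ψ)` is null for the form of `E` at `(1, b)`, hence for
that of `Φ`. -/
lemma eq_map_one_mul_of_isStarRep_add (hΦ : IsCP Φ) (hΨ : IsCP Ψ) (hE : IsStarRep (Φ + Ψ))
    (hone : (Φ + Ψ) 1 = 1) (b : K →L[ℂ] K) : Φ b = Φ 1 * (Φ + Ψ) b := by
  refine ContinuousLinearMap.ext fun ψ => ?_
  let a : Fin 2 → K →L[ℂ] K := ![1, b]
  let φ : Fin 2 → H := ![-(Φ + Ψ) b ψ, ψ]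
  have hnull : ∑ j, ∑ k, ⟪φ j, (Φ + Ψ) (star (a j) * a k) (φ k)⟫_ℂ = 0 := by
    have hrow : ∀ j, ∑ k, (Φ + Ψ) (star (a j) * a k) (φ k) = 0 := fun j => by
      simp only [hE.1, mul_apply_eq_comp, ← map_sum, Fin.sum_univ_two, a, φ,
        Matrix.cons_val_zero, Matrix.cons_val_one, hone, one_apply_eq_self, neg_add_cancel,
        map_zero]
    simp only [← inner_sum, hrow, inner_zero_right, Finset.sum_const_zero]
  have hnullΦ : ∑ j, ∑ k, ⟪φ j, Φ (star (a j) * a k) (φ k)⟫_ℂ = 0 := by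
    simp only [LinearMap.add_apply, add_apply, inner_add_right, Finset.sum_add_distrib] at hnull
    exact ((add_eq_zero_iff_of_nonneg (hΦ 2 a φ) (hΨ 2 a φ)).1 hnull).1
  have hker := hΦ.sum_apply_eq_zero a φ hnullΦ 0
  simp only [a, φ, Fin.sum_univ_two, Matrix.cons_val_zero, Matrix.cons_val_one, star_one, one_mul,
    map_neg, neg_add_eq_zero] at hker
  exact hker.symm

lemma eq_mul_map_one_of_isStarRep_add (hΦ : IsCP Φ) (hΨ : IsCP Ψ) (hE : IsStarRep (Φ + Ψ))
    (hone : (Φ + Ψ) 1 = 1) (b : K →L[ℂ] K) : Φ b = (Φ + Ψ) b * Φ 1 := by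
  have h := congrArg star (hΦ.eq_map_one_mul_of_isStarRep_add hΨ hE hone (star b))
  rwa [star_mul, hE.2, star_star, hΦ.map_star, star_star, ← hΦ.map_star, star_one] at h

end IsCP

variable [CompleteSpace H] in
lemma IsNormalMap.add (hΦ : IsNormalMap Φ) (hΨ : IsNormalMap Ψ) : IsNormalMap (Φ + Ψ) := by
  unfold IsNormalMap at *
  let := ultraweak K
  let := ultraweak H
  rw [continuous_induced_rng] at *
  convert hΦ.add hΨ using 1
  ext A T
  exact tr_mul_add T.2 _ _

lemma linearMap_ext_effects {A V : Type*} [CStarAlgebra A] [PartialOrder A] [StarOrderedRing A]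
    [AddCommMonoid V] [Module ℂ V] {f g : A →ₗ[ℂ] V} (h : ∀ b, 0 ≤ b → b ≤ 1 → f b = g b) :
    f = g :=
  LinearMap.ext_on CStarAlgebra.span_nonneg_inter_unitClosedBall fun b hb =>
    h b hb.1 ((CStarAlgebra.norm_le_one_iff_of_nonneg b hb.1).1 (mem_closedBall_zero_iff.1 hb.2))

end CompletelyPositive

section Instruments

variable {Ω : Type*} [MeasurableSpace Ω] {ν : Measure Ω}
variable {H : Type*} [NormedAddCommGroup H] [InnerProductSpace ℂ H] [CompleteSpace H]
variable {K : Type*} [NormedAddCommGroup K] [InnerProductSpace ℂ K] [CompleteSpace K]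
variable {Γ Δ : Set Ω → (K →L[ℂ] K) →ₗ[ℂ] (H →L[ℂ] H)} {M : Set Ω → H →L[ℂ] H}
  {E : (K →L[ℂ] K) →ₗ[ℂ] (H →L[ℂ] H)}

lemma instruments_eq_instrumentsOn_count :
    instruments Ω H K = instrumentsOn H K Measure.count := by
  refine (Set.sep_eq_self_iff_mem_true.2 fun Γ hΓ X _ hX => LinearMap.ext fun B => ?_).symm
  rw [Measure.count_eq_zero_iff.1 hX, (hΓ.1 B).apply_empty, LinearMap.zero_apply]

lemma instruments_apply_add_apply_compl (hΓ : Γ ∈ instruments Ω H K) {X : Set Ω}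
    (hX : MeasurableSet X) : Γ X + Γ Xᶜ = Γ Set.univ :=
  LinearMap.ext fun B => (hΓ.1 B).apply_add_apply_compl hX

lemma instruments_ext (hΓ : Γ ∈ instruments Ω H K) (hΔ : Δ ∈ instruments Ω H K)
    (h : ∀ X, MeasurableSet X → Γ X = Δ X) : Γ = Δ := by
  ext X B : 2
  by_cases hX : MeasurableSet X
  · rw [h X hX]
  · exact ((hΓ.1 B).1 X hX).trans ((hΔ.1 B).1 X hX).symm

variable (Ω H K) in
/-- The marginals `(Γ(·, 1), Γ(Ω, ·))` of an instrument `Γ`, as a linear map, so that extremality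
can be transported along it. -/
noncomputable def instrumentMarginals : (Set Ω → (K →L[ℂ] K) →ₗ[ℂ] (H →L[ℂ] H)) →ₗ[ℝ]
    (Set Ω → H →L[ℂ] H) × ((K →L[ℂ] K) →ₗ[ℂ] (H →L[ℂ] H)) where
  toFun Γ := (fun X => Γ X 1, Γ Set.univ)
  map_add' _ _ := rfl
  map_smul' _ _ := rfl

lemma isJointInstrument_iff_instrumentMarginals (hΓ : Γ ∈ instruments Ω H K)
    (hM : IsOperatorMeasure M) :
    IsJointInstrument Γ M E ↔ instrumentMarginals Ω H K Γ = (M, E) := by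
  refine ⟨fun h => Prod.ext (funext fun X => ?_) h.2, fun h => ?_⟩
  · by_cases hX : MeasurableSet X
    · exact h.1 X hX
    · exact ((hΓ.1 1).1 X hX).trans (hM.1 X hX).symm
  · obtain ⟨hfst, hsnd⟩ := Prod.ext_iff.1 h
    exact ⟨fun X _ => congrFun hfst X, hsnd⟩

lemma mapsTo_instrumentMarginals : Set.MapsTo (instrumentMarginals Ω H K) (instrumentsOn H K ν)
    (observablesOn H ν ×ˢ channels K H) := fun _ hΓ =>
  ⟨⟨hΓ.1.2.1, fun X hX hνX => LinearMap.congr_fun (hΓ.2 X hX hνX) 1⟩, hΓ.1.2.2.2⟩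

namespace IsJointInstrument

lemma apply_add_apply_one_sub_mem_observablesOn (hM : M ∈ observablesOn H ν)
    (hΓ : Γ ∈ instruments Ω H K) (hΔ : Δ ∈ instruments Ω H K) (hΓj : IsJointInstrument Γ M E)
    (hΔj : IsJointInstrument Δ M E) {B : K →L[ℂ] K} (hB₀ : 0 ≤ B) (hB₁ : B ≤ 1) :
    (fun X => Γ X B) + (fun X => Δ X (1 - B)) ∈ observablesOn H ν := by
  have hB₀' : 0 ≤ 1 - B := sub_nonneg.2 hB₁
  have happly_le : ∀ {Γ : Set Ω → (K →L[ℂ] K) →ₗ[ℂ] (H →L[ℂ] H)} {B : K →L[ℂ] K},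
      Γ ∈ instruments Ω H K → IsJointInstrument Γ M E → B ≤ 1 → (fun X => Γ X B) ≤ M :=
    fun {Γ _} hΓ hΓj hB X =>
      have hone : Γ X 1 = M X := congrFun (congrArg Prod.fst
        ((isJointInstrument_iff_instrumentMarginals hΓ hM.1.1).1 hΓj)) X
      ((hΓ.2.2.1 X).1.monotone hB).trans_eq hone
  refine add_mem_observablesOn hM (hΓ.1 B) (hΔ.1 _) (fun X => (hΓ.2.2.1 X).1.nonneg hB₀)
    (fun X => (hΔ.2.2.1 X).1.nonneg hB₀') (happly_le hΓ hΓj hB₁)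
    (happly_le hΔ hΔj (sub_le_self 1 hB₀)) ?_
  rw [hΓj.2, ← hΔj.2, ← map_add, add_sub_cancel]
  exact hΔ.2.2.2.2.2

lemma eq_of_observable_mem_extremePoints (hM : M ∈ (observablesOn H ν).extremePoints ℝ)
    (hΓ : Γ ∈ instruments Ω H K) (hΔ : Δ ∈ instruments Ω H K) (hΓj : IsJointInstrument Γ M E)
    (hΔj : IsJointInstrument Δ M E) : Γ = Δ := by
  have hsum : ∀ {Γ}, Γ ∈ instruments Ω H K → IsJointInstrument Γ M E → ∀ B,
      (fun X => Γ X B) + (fun X => Γ X (1 - B)) = M := fun {Γ} hΓ hΓj B => by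
    have hone : (fun X => Γ X 1) = M := congrArg Prod.fst
      ((isJointInstrument_iff_instrumentMarginals hΓ hM.1.1.1).1 hΓj)
    ext X : 1
    rw [← hone, Pi.add_apply, ← map_add, add_sub_cancel]
  refine instruments_ext hΓ hΔ fun X _ => linearMap_ext_effects fun B hB₀ hB₁ => ?_
  exact congrFun (eq_of_add_eq_of_mem_extremePoints hM (hsum hΓ hΓj B) (hsum hΔ hΔj B)
    (apply_add_apply_one_sub_mem_observablesOn hM.1 hΓ hΔ hΓj hΔj hB₀ hB₁)
    (apply_add_apply_one_sub_mem_observablesOn hM.1 hΔ hΓ hΔj hΓj hB₀ hB₁)) X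

lemma apply_add_apply_compl_mem_channels (hΓ : Γ ∈ instruments Ω H K)
    (hΔ : Δ ∈ instruments Ω H K) (hΓj : IsJointInstrument Γ M E) (hΔj : IsJointInstrument Δ M E)
    {X : Set Ω} (hX : MeasurableSet X) : Γ X + Δ Xᶜ ∈ channels K H := by
  refine ⟨(hΓ.2.2.1 _).1.add (hΔ.2.2.1 _).1, (hΓ.2.2.1 _).2.add (hΔ.2.2.1 _).2, ?_⟩
  rw [LinearMap.add_apply, hΓj.1 X hX, ← hΔj.1 X hX, ← LinearMap.add_apply,
    instruments_apply_add_apply_compl hΔ hX]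
  exact hΔ.2.2.2.2.2

lemma eq_of_channel_mem_extremePoints (hE : E ∈ (channels K H).extremePoints ℝ)
    (hΓ : Γ ∈ instruments Ω H K) (hΔ : Δ ∈ instruments Ω H K) (hΓj : IsJointInstrument Γ M E)
    (hΔj : IsJointInstrument Δ M E) : Γ = Δ :=
  instruments_ext hΓ hΔ fun _ hX => eq_of_add_eq_of_mem_extremePoints hE
    ((instruments_apply_add_apply_compl hΓ hX).trans hΓj.2)
    ((instruments_apply_add_apply_compl hΔ hX).trans hΔj.2)
    (apply_add_apply_compl_mem_channels hΓ hΔ hΓj hΔj hX)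
    (apply_add_apply_compl_mem_channels hΔ hΓ hΔj hΓj hX)

lemma mem_extremePoints (hΓ : Γ ∈ instrumentsOn H K ν)
    (hM : M ∈ (observablesOn H ν).extremePoints ℝ) (hE : E ∈ (channels K H).extremePoints ℝ)
    (hΓj : IsJointInstrument Γ M E) : Γ ∈ (instrumentsOn H K ν).extremePoints ℝ := by
  have hmarginals : instrumentMarginals Ω H K Γ = (M, E) :=
    (isJointInstrument_iff_instrumentMarginals hΓ.1 hM.1.1.1).1 hΓj
  refine mem_extremePoints_of_mapsTo (instrumentMarginals Ω H K) mapsTo_instrumentMarginals hΓ ?_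
    fun Δ hΔ hΔΓ => ?_
  · rw [hmarginals, extremePoints_prod]
    exact ⟨hM, hE⟩
  · exact eq_of_observable_mem_extremePoints hM hΔ.1 hΓ.1
      ((isJointInstrument_iff_instrumentMarginals hΔ.1 hM.1.1.1).2 (hΔΓ.trans hmarginals)) hΓj

lemma apply_eq_mul_of_isSharp (hM : IsSharp M) (hΓ : Γ ∈ instruments Ω H K)
    (hΓj : IsJointInstrument Γ M E) {X : Set Ω} (hX : MeasurableSet X) (B : K →L[ℂ] K) :
    Γ X B = M X * E B ∧ Γ X B = E B * M X := by
  have hcp : ∀ Y, IsCP (Γ Y) := fun Y => (hΓ.2.2.1 Y).1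
  have hE : Γ X + Γ Xᶜ = E := (instruments_apply_add_apply_compl hΓ hX).trans hΓj.2
  have hcompl : Γ Xᶜ 1 = 1 - M X := by
    rw [eq_sub_iff_add_eq', ← hΓj.1 X hX, ← LinearMap.add_apply, hE, ← hΓj.2]
    exact hΓ.2.2.2.2.2
  have heffect : ∀ B, 0 ≤ B → B ≤ 1 → Γ X B = M X * E B ∧ Γ X B = E B * M X := by
    intro B hB₀ hB₁
    rw [← hE]
    exact eq_mul_add_of_le_of_le_one_sub (hM X hX) ((hcp X).nonneg hB₀) ((hcp _).nonneg hB₀)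
      (((hcp X).monotone hB₁).trans_eq (hΓj.1 X hX)) (((hcp _).monotone hB₁).trans_eq hcompl)
  have hleft : Γ X = LinearMap.mulLeft ℂ (M X) ∘ₗ E :=
    linearMap_ext_effects fun B hB₀ hB₁ => (heffect B hB₀ hB₁).1
  have hright : Γ X = LinearMap.mulRight ℂ (M X) ∘ₗ E :=
    linearMap_ext_effects fun B hB₀ hB₁ => (heffect B hB₀ hB₁).2
  exact ⟨LinearMap.congr_fun hleft B, LinearMap.congr_fun hright B⟩

lemma apply_eq_mul_of_isStarRep (hE : IsStarRep E) (hΓ : Γ ∈ instruments Ω H K)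
    (hΓj : IsJointInstrument Γ M E) {X : Set Ω} (hX : MeasurableSet X) (B : K →L[ℂ] K) :
    Γ X B = M X * E B ∧ Γ X B = E B * M X := by
  have hsum : Γ X + Γ Xᶜ = E := (instruments_apply_add_apply_compl hΓ hX).trans hΓj.2
  have hone : E 1 = 1 := hΓj.2 ▸ hΓ.2.2.2.2.2
  rw [← hΓj.1 X hX]
  rw [← hsum] at hE hone ⊢
  exact ⟨(hΓ.2.2.1 X).1.eq_map_one_mul_of_isStarRep_add (hΓ.2.2.1 Xᶜ).1 hE hone B,
    (hΓ.2.2.1 X).1.eq_mul_map_one_of_isStarRep_add (hΓ.2.2.1 Xᶜ).1 hE hone B⟩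

lemma apply_eq_mul (h : IsSharp M ∨ IsStarRep E) (hΓ : Γ ∈ instruments Ω H K)
    (hΓj : IsJointInstrument Γ M E) {X : Set Ω} (hX : MeasurableSet X) (B : K →L[ℂ] K) :
    Γ X B = M X * E B ∧ Γ X B = E B * M X :=
  h.elim (apply_eq_mul_of_isSharp · hΓ hΓj hX B) (apply_eq_mul_of_isStarRep · hΓ hΓj hX B)

lemma commute (h : IsSharp M ∨ IsStarRep E) (hΓ : Γ ∈ instruments Ω H K)
    (hΓj : IsJointInstrument Γ M E) {X : Set Ω} (hX : MeasurableSet X) (B : K →L[ℂ] K) :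
    Commute (M X) (E B) :=
  (apply_eq_mul h hΓ hΓj hX B).1.symm.trans (apply_eq_mul h hΓ hΓj hX B).2

lemma apply_eq_sqrt_mul_mul_sqrt (h : IsSharp M ∨ IsStarRep E) (hΓ : Γ ∈ instruments Ω H K)
    (hΓj : IsJointInstrument Γ M E) {X : Set Ω} (hX : MeasurableSet X) (B : K →L[ℂ] K) :
    Γ X B = CFC.sqrt (M X) * E B * CFC.sqrt (M X) := by
  have hMX : 0 ≤ M X := hΓj.1 X hX ▸ hΓ.2.1.2.1 X
  rw [(apply_eq_mul h hΓ hΓj hX B).1, mul_eq_sqrt_mul_mul_sqrt hMX (commute h hΓ hΓj hX B)]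

lemma eq_of_isSharp_or_isStarRep (h : IsSharp M ∨ IsStarRep E) (hΓ : Γ ∈ instruments Ω H K)
    (hΔ : Δ ∈ instruments Ω H K) (hΓj : IsJointInstrument Γ M E)
    (hΔj : IsJointInstrument Δ M E) : Γ = Δ :=
  instruments_ext hΓ hΔ fun _ hX => LinearMap.ext fun B =>
    (apply_eq_mul h hΓ hΓj hX B).1.trans (apply_eq_mul h hΔ hΔj hX B).1.symm

end IsJointInstrument

end Instruments

section Trace

variable {H : Type*} [NormedAddCommGroup H] [InnerProductSpace ℂ H]

lemma ext_inner_apply_self {A B : H →L[ℂ] H} (h : ∀ x, ⟪x, A x⟫_ℂ = ⟪x, B x⟫_ℂ) : A = B := by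
  refine ContinuousLinearMap.coe_injective ((ext_inner_map _ _).1 fun x => ?_)
  rw [← inner_conj_symm, ContinuousLinearMap.coe_coe, h x, inner_conj_symm,
    ContinuousLinearMap.coe_coe]

lemma exists_inner_apply_self_ne_zero {A : H →L[ℂ] H} (hA : A ≠ 0) : ∃ x, ⟪x, A x⟫_ℂ ≠ 0 := by
  by_contra! hzero
  exact hA (ext_inner_apply_self fun x => by rw [hzero, zero_apply, inner_zero_right])

variable [CompleteSpace H]

lemma tr_add {A B : H →L[ℂ] H} (hA : A ∈ traceClass H) (hB : B ∈ traceClass H) :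
    tr (A + B) = tr A + tr B := by
  simp only [tr, add_apply, inner_add_right]
  exact (summable_inner_of_mem_traceClass hA).tsum_add (summable_inner_of_mem_traceClass hB)

lemma tr_smul (c : ℂ) (A : H →L[ℂ] H) : tr (c • A) = c * tr A := by
  simp only [tr, smul_apply, inner_smul_right, tsum_mul_left]

lemma inner_apply_le_norm_sq_mul_of_hasSum {ι : Type*} (b : HilbertBasis ι ℂ H) {T : H →L[ℂ] H}
    (hT : 0 ≤ T) {s : ℂ} (hs : HasSum (fun i => ⟪b i, T (b i)⟫_ℂ) s) (x : H) :
    ⟪x, T x⟫_ℂ ≤ (‖x‖ ^ 2 : ℝ) * s := by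
  have hsqrt : (CFC.sqrt T).IsPositive :=
    (ContinuousLinearMap.nonneg_iff_isPositive _).1 (CFC.sqrt_nonneg T)
  rw [← norm_sqrt_apply_sq hT x]
  refine hasSum_le (fun i => ?_)
    (Complex.hasSum_ofReal.2 (hasSum_norm_inner_sq b (CFC.sqrt T x))) (hs.mul_left _)
  rw [← norm_sqrt_apply_sq hT, ← Complex.ofReal_mul, Complex.real_le_real, ← mul_pow,
    mul_comm ‖x‖, ← hsqrt.inner_left_eq_inner_right]
  exact pow_le_pow_left₀ (norm_nonneg _) (norm_inner_le_norm _ _) 2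

lemma mem_traceClass_of_le {A T : H →L[ℂ] H} (hA : 0 ≤ A) (hAT : A ≤ T) (hT : T ∈ traceClass H) :
    A ∈ traceClass H := by
  refine Submodule.subset_span ⟨hA, ?_⟩
  refine Summable.of_norm_bounded (summable_inner_of_mem_traceClass hT).norm fun i => ?_
  exact CStarAlgebra.norm_le_norm_of_nonneg_of_le (nonneg_iff_forall_inner_nonneg.1 hA _)
    (le_iff_forall_inner_le.1 hAT _)

lemma tr_pos {A : H →L[ℂ] H} (hA : 0 ≤ A) (hAt : A ∈ traceClass H) (hA0 : A ≠ 0) : 0 < tr A := by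
  refine (tsum_nonneg fun i => nonneg_iff_forall_inner_nonneg.1 hA _).lt_of_ne' fun h => hA0 ?_
  have hsum : HasSum (fun i => ⟪basis H i, A (basis H i)⟫_ℂ) 0 :=
    h ▸ (summable_inner_of_mem_traceClass hAt).hasSum
  refine ext_inner_apply_self fun x =>
    le_antisymm ?_ (by simpa using nonneg_iff_forall_inner_nonneg.1 hA x)
  simpa using inner_apply_le_norm_sq_mul_of_hasSum (basis H) hA hsum x

lemma exists_eq_smul_mem_states {A : H →L[ℂ] H} (hA : 0 ≤ A) (hAt : A ∈ traceClass H)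
    (hA0 : A ≠ 0) : ∃ r : ℝ, 0 < r ∧ tr A = r ∧ ∃ ρ ∈ states H, A = r • ρ := by
  obtain ⟨r, hr⟩ : ∃ r : ℝ, tr A = r :=
    ⟨_, Complex.eq_re_of_ofReal_le (r := 0) (mod_cast (tr_pos hA hAt hA0).le)⟩
  have hr0 : 0 < r := by exact_mod_cast hr ▸ tr_pos hA hAt hA0
  have hc : ((r⁻¹ : ℝ) : ℂ) • A ∈ states H := by
    refine ⟨smul_nonneg (mod_cast (inv_pos.2 hr0).le) hA, Submodule.smul_mem _ _ hAt, ?_⟩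
    rw [tr_smul, hr, ← Complex.ofReal_mul, inv_mul_cancel₀ hr0.ne', Complex.ofReal_one]
  exact ⟨r, hr0, hr, _, hc, by rw [Complex.coe_smul, smul_inv_smul₀ hr0.ne']⟩

end Trace

section Pure

open InnerProductSpace

variable {H : Type*} [NormedAddCommGroup H] [InnerProductSpace ℂ H]

/-- Purity of an unnormalized state, without reference to the trace: `P` is nonzero and the
positive operators below `P` are multiples of `P`. -/
def IsPure (P : H →L[ℂ] H) : Prop := P ≠ 0 ∧ ∀ A, 0 ≤ A → A ≤ P → ∃ c : ℂ, A = c • P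

lemma rankOne_self_nonneg (φ : H) : 0 ≤ rankOne ℂ φ φ :=
  (ContinuousLinearMap.nonneg_iff_isPositive _).2 (isPositive_rankOne_self φ)

variable [CompleteSpace H]

lemma isPure_of_mem_extremePoints {P : H →L[ℂ] H} (hP : P ∈ (states H).extremePoints ℝ) :
    IsPure P := by
  obtain ⟨⟨-, hPt, hP1⟩, hext⟩ := hP
  refine ⟨fun h => by simp [h, tr] at hP1, fun A hA hAP => ?_⟩
  have hAt := mem_traceClass_of_le hA hAP hPt
  have hBt : P - A ∈ traceClass H := Submodule.sub_mem _ hPt hAt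
  by_cases hA0 : A = 0
  · exact ⟨0, by rw [hA0, zero_smul]⟩
  by_cases hB0 : P - A = 0
  · exact ⟨1, by rw [one_smul, sub_eq_zero.1 hB0]⟩
  obtain ⟨r, hr, htrA, ρ, hρ, hAρ⟩ := exists_eq_smul_mem_states hA hAt hA0
  obtain ⟨s, hs, htrB, σ, hσ, hBσ⟩ := exists_eq_smul_mem_states (sub_nonneg.2 hAP) hBt hB0
  have hrs : r + s = 1 := by
    have htr := tr_add hAt hBt
    rw [add_sub_cancel, hP1, htrA, htrB] at htr
    exact_mod_cast htr.symm
  have hρP : ρ = P :=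
    hext hρ hσ ⟨r, s, hr, hs, hrs, by rw [← hAρ, ← hBσ, add_sub_cancel]⟩
  exact ⟨r, by rw [Complex.coe_smul, ← hρP, hAρ]⟩

lemma IsPure.exists_eq_smul_of_le_smul {P A : H →L[ℂ] H} (hP : IsPure P) (hA : 0 ≤ A) {r : ℝ}
    (hr : 0 ≤ r) (h : A ≤ r • P) : ∃ c : ℂ, A = c • P := by
  rcases hr.eq_or_lt with rfl | hr
  · exact ⟨0, by rw [zero_smul]; exact le_antisymm (by simpa using h) hA⟩
  · obtain ⟨c, hc⟩ := hP.2 (r⁻¹ • A) (smul_nonneg (inv_nonneg.2 hr.le) hA)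
      (inv_smul_smul₀ hr.ne' P ▸ smul_le_smul_of_nonneg_left h (inv_nonneg.2 hr.le))
    exact ⟨r * c, by rw [mul_smul, ← hc, Complex.coe_smul, smul_inv_smul₀ hr.ne']⟩

lemma exists_eq_smul_rankOne {A : H →L[ℂ] H} (hA : 0 ≤ A) {φ : H}
    (h : ∀ y, ⟪φ, y⟫_ℂ = 0 → ⟪y, A y⟫_ℂ = 0) : ∃ c : ℂ, A = c • rankOne ℂ φ φ := by
  have hsymm := ((ContinuousLinearMap.nonneg_iff_isPositive A).1 hA).inner_left_eq_inner_right
  have happly : ∀ x, A x = (⟪φ, x⟫_ℂ / ⟪φ, φ⟫_ℂ) • A φ := fun x => by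
    have hperp : ⟪φ, x - (⟪φ, x⟫_ℂ / ⟪φ, φ⟫_ℂ) • φ⟫_ℂ = 0 := by
      rcases eq_or_ne φ 0 with rfl | hφ
      · exact inner_zero_left _
      · rw [inner_sub_right, inner_smul_right, div_mul_cancel₀ _ (inner_self_ne_zero.2 hφ),
          sub_self]
    rw [← map_smul, ← sub_eq_zero, ← map_sub]
    exact apply_eq_zero_of_inner_eq_zero hA (h _ hperp)
  refine ⟨⟪φ, A φ⟫_ℂ / ⟪φ, φ⟫_ℂ ^ 2, ext_inner_apply_self fun x => ?_⟩
  rw [happly x, inner_smul_right, ← hsymm, happly x, inner_smul_left, hsymm, map_div₀,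
    inner_conj_symm, inner_conj_symm, smul_apply, inner_smul_right, inner_right_rankOne_apply]
  ring

lemma isPure_rankOne {φ : H} (hφ : φ ≠ 0) : IsPure (rankOne ℂ φ φ) := by
  refine ⟨rankOne_ne_zero hφ hφ, fun A hA hle => exists_eq_smul_rankOne hA fun y hy => ?_⟩
  refine le_antisymm ?_ (nonneg_iff_forall_inner_nonneg.1 hA y)
  simpa only [inner_right_rankOne_apply, hy, mul_zero] using le_iff_forall_inner_le.1 hle y

lemma rankOne_self_mem_traceClass (φ : H) : rankOne ℂ φ φ ∈ traceClass H := by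
  refine Submodule.subset_span ⟨rankOne_self_nonneg φ, ?_⟩
  simpa only [inner_right_rankOne_apply, mul_comm] using (basis H).summable_inner_mul_inner φ φ

lemma tr_mul_rankOne (T : H →L[ℂ] H) (x y : H) : tr (T * rankOne ℂ x y) = ⟪y, T x⟫_ℂ := by
  rw [← (basis H).tsum_inner_mul_inner y (T x)]
  refine tsum_congr fun i => ?_
  rw [mul_apply_eq_comp, rankOne_apply, map_smul, inner_smul_right]

lemma tr_rankOne_mul (A : H →L[ℂ] H) (x y : H) : tr (rankOne ℂ x y * A) = ⟪y, A x⟫_ℂ := by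
  rw [← ContinuousLinearMap.adjoint_inner_left, ← (basis H).tsum_inner_mul_inner _ x]
  refine tsum_congr fun i => ?_
  rw [mul_apply_eq_comp, inner_right_rankOne_apply, ContinuousLinearMap.adjoint_inner_left,
    mul_comm]

end Pure

section PartialTrace

variable {H₁ : Type*} [NormedAddCommGroup H₁] [InnerProductSpace ℂ H₁] [CompleteSpace H₁]
variable {H₂ : Type*} [NormedAddCommGroup H₂] [InnerProductSpace ℂ H₂] [CompleteSpace H₂]
variable {G : Type*} [NormedAddCommGroup G] [InnerProductSpace ℂ G] [CompleteSpace G]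
variable {τ : H₁ →L[ℂ] H₂ →L[ℂ] G} {ρ : G →L[ℂ] G}

lemma inner_adjoint_comp_comp (V W : H₂ →L[ℂ] G) (ρ : G →L[ℂ] G) (x y : H₂) :
    ⟪x, (V.adjoint ∘L ρ ∘L W) y⟫_ℂ = ⟪V x, ρ (W y)⟫_ℂ :=
  ContinuousLinearMap.adjoint_inner_right V x (ρ (W y))

lemma adjoint_comp_comp_nonneg (V : H₂ →L[ℂ] G) (hρ : 0 ≤ ρ) : 0 ≤ V.adjoint ∘L ρ ∘L V :=
  (ContinuousLinearMap.nonneg_iff_isPositive _).2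
    (((ContinuousLinearMap.nonneg_iff_isPositive ρ).1 hρ).adjoint_conj V)

/-- The partial trace over the first factor, for an arbitrary bounded bilinear map `τ` in place of
the tensor product map; `τ.flip` exchanges the roles of the two factors. -/
noncomputable def ptrace (τ : H₁ →L[ℂ] H₂ →L[ℂ] G) (ρ : G →L[ℂ] G) : H₂ →L[ℂ] H₂ :=
  ∑' i, (τ (basis H₁ i)).adjoint ∘L ρ ∘L τ (basis H₁ i)

lemma hasSum_inner_ptrace (h0 : ptrace τ ρ ≠ 0) (x : H₂) :
    HasSum (fun i => ⟪τ (basis H₁ i) x, ρ (τ (basis H₁ i) x)⟫_ℂ) ⟪x, ptrace τ ρ x⟫_ℂ := by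
  -- A partial trace that is not summable has the junk value `0`.
  have hs : Summable fun i => (τ (basis H₁ i)).adjoint ∘L ρ ∘L τ (basis H₁ i) :=
    not_imp_comm.1 tsum_eq_zero_of_not_summable h0
  simpa only [ptrace, ContinuousLinearMap.apply_apply, innerSL_apply_apply,
    inner_adjoint_comp_comp] using
    (hs.hasSum.mapL (ContinuousLinearMap.apply ℂ H₂ x)).mapL (innerSL ℂ x)

lemma adjoint_comp_comp_le_ptrace (hρ : 0 ≤ ρ) (h0 : ptrace τ ρ ≠ 0) (φ : H₁) :
    (τ φ).adjoint ∘L ρ ∘L τ φ ≤ (‖φ‖ ^ 2) • ptrace τ ρ := by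
  refine le_iff_forall_inner_le.2 fun x => ?_
  have hsum : HasSum (fun i => ⟪basis H₁ i, ((τ.flip x).adjoint ∘L ρ ∘L τ.flip x) (basis H₁ i)⟫_ℂ)
      ⟪x, ptrace τ ρ x⟫_ℂ := by
    simpa only [inner_adjoint_comp_comp, ContinuousLinearMap.flip_apply] using
      hasSum_inner_ptrace h0 x
  have hle := inner_apply_le_norm_sq_mul_of_hasSum _ (adjoint_comp_comp_nonneg _ hρ) hsum φ
  rw [inner_adjoint_comp_comp] at hle ⊢
  rwa [smul_apply, ← Complex.coe_smul, inner_smul_right]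

lemma exists_inner_eq_mul_of_forall_adjoint_comp_comp {P : H₂ →L[ℂ] H₂} (hP : P ≠ 0)
    (h : ∀ φ, ∃ c : ℂ, (τ φ).adjoint ∘L ρ ∘L τ φ = c • P) : ∃ C : H₁ →L[ℂ] H₁, ∀ φ' φ ψ' ψ,
      ⟪τ φ' ψ', ρ (τ φ ψ)⟫_ℂ = ⟪φ', C φ⟫_ℂ * ⟪ψ', P ψ⟫_ℂ := by
  choose c hc using h
  obtain ⟨x, hx⟩ := exists_inner_apply_self_ne_zero hP
  have hdiag : ∀ φ ψ' ψ, ⟪τ φ ψ', ρ (τ φ ψ)⟫_ℂ = c φ * ⟪ψ', P ψ⟫_ℂ := fun φ ψ' ψ => by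
    rw [← inner_adjoint_comp_comp, hc, smul_apply, inner_smul_right]
  let C := (⟪x, P x⟫_ℂ)⁻¹ • ((τ.flip x).adjoint ∘L ρ ∘L τ.flip x)
  have hC : ∀ φ, ⟪φ, C φ⟫_ℂ = c φ := fun φ => by
    rw [smul_apply, inner_smul_right, inner_adjoint_comp_comp, ContinuousLinearMap.flip_apply,
      hdiag, mul_comm, mul_inv_cancel_right₀ hx]
  refine ⟨C, fun φ' φ ψ' ψ => ?_⟩
  have hpolar : (τ.flip ψ').adjoint ∘L ρ ∘L τ.flip ψ = ⟪ψ', P ψ⟫_ℂ • C :=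
    ext_inner_apply_self fun φ => by
      rw [inner_adjoint_comp_comp, ContinuousLinearMap.flip_apply, ContinuousLinearMap.flip_apply,
        hdiag, smul_apply, inner_smul_right, hC, mul_comm]
  have hoff := inner_adjoint_comp_comp (τ.flip ψ') (τ.flip ψ) ρ φ' φ
  rw [hpolar, smul_apply, inner_smul_right] at hoff
  rw [mul_comm]
  exact hoff.symm

lemma exists_inner_eq_mul_of_isPure (hρ : 0 ≤ ρ) (hP : IsPure (ptrace τ ρ)) :
    ∃ C : H₁ →L[ℂ] H₁, ∀ φ' φ ψ' ψ,
      ⟪τ φ' ψ', ρ (τ φ ψ)⟫_ℂ = ⟪φ', C φ⟫_ℂ * ⟪ψ', ptrace τ ρ ψ⟫_ℂ :=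
  exists_inner_eq_mul_of_forall_adjoint_comp_comp hP.1 fun φ =>
    hP.exists_eq_smul_of_le_smul (adjoint_comp_comp_nonneg _ hρ) (sq_nonneg _)
      (adjoint_comp_comp_le_ptrace hρ hP.1 φ)

lemma ptrace_flip_of_inner_eq_mul {C : H₁ →L[ℂ] H₁} {P : H₂ →L[ℂ] H₂}
    (h : ∀ φ' φ ψ' ψ, ⟪τ φ' ψ', ρ (τ φ ψ)⟫_ℂ = ⟪φ', C φ⟫_ℂ * ⟪ψ', P ψ⟫_ℂ)
    (hP : P ∈ traceClass H₂) : ptrace τ.flip ρ = tr P • C := by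
  have hslice : ∀ ψ, (τ.flip ψ).adjoint ∘L ρ ∘L τ.flip ψ = ⟪ψ, P ψ⟫_ℂ • C := fun ψ =>
    ext_inner_apply_self fun φ => by
      rw [inner_adjoint_comp_comp, smul_apply, inner_smul_right, mul_comm]
      exact h φ φ ψ ψ
  simp only [ptrace, hslice]
  exact (summable_inner_of_mem_traceClass hP).tsum_smul_const C

lemma mem_states_of_inner_eq_mul (hρ : 0 ≤ ρ) (h0 : ptrace τ ρ ≠ 0) {C : H₁ →L[ℂ] H₁}
    (h : ∀ φ' φ ψ' ψ, ⟪τ φ' ψ', ρ (τ φ ψ)⟫_ℂ = ⟪φ', C φ⟫_ℂ * ⟪ψ', ptrace τ ρ ψ⟫_ℂ) :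
    C ∈ states H₁ := by
  have hnonneg := nonneg_iff_forall_inner_nonneg.1 hρ
  obtain ⟨x, hx⟩ := exists_inner_apply_self_ne_zero h0
  have hsum := hasSum_inner_ptrace h0 x
  have hpos : 0 < ⟪x, ptrace τ ρ x⟫_ℂ := (hsum.nonneg fun i => hnonneg _).lt_of_ne' hx
  have hC : 0 ≤ C := nonneg_iff_forall_inner_nonneg.2 fun φ => by
    have hmul := mul_nonneg (hnonneg (τ φ x)) (RCLike.inv_pos_of_pos hpos).le
    rwa [h, mul_inv_cancel_right₀ hx] at hmul
  have htr : HasSum (fun i => ⟪basis H₁ i, C (basis H₁ i)⟫_ℂ) 1 := by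
    simpa only [h, mul_div_cancel_right₀ _ hx, div_self hx] using
      hsum.div_const ⟪x, ptrace τ ρ x⟫_ℂ
  exact ⟨hC, Submodule.subset_span ⟨hC, htr.summable⟩, htr.tsum_eq⟩

lemma inner_eq_mul_of_mem_extremePoints (hρ : 0 ≤ ρ)
    (hP : ptrace τ ρ ∈ (states H₂).extremePoints ℝ) (φ' φ : H₁) (ψ' ψ : H₂) :
    ⟪τ φ' ψ', ρ (τ φ ψ)⟫_ℂ = ⟪φ', ptrace τ.flip ρ φ⟫_ℂ * ⟪ψ', ptrace τ ρ ψ⟫_ℂ := by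
  obtain ⟨C, hC⟩ := exists_inner_eq_mul_of_isPure hρ (isPure_of_mem_extremePoints hP)
  obtain ⟨-, htraceClass, htr⟩ := hP.1
  rw [ptrace_flip_of_inner_eq_mul hC htraceClass, htr, one_smul, hC]

end PartialTrace

section HilbertTensor

variable {H₁ : Type*} [NormedAddCommGroup H₁] [InnerProductSpace ℂ H₁]
variable {H₂ : Type*} [NormedAddCommGroup H₂] [InnerProductSpace ℂ H₂]

variable (H₁ H₂) in
/-- The map `(φ, ψ) ↦ φ ⊗ ψ` into the Hilbert space tensor product, as a bounded bilinear map. -/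
noncomputable def tensorMk : H₁ →L[ℂ] H₂ →L[ℂ] HTensor H₁ H₂ :=
  ContinuousLinearMap.compL ℂ H₂ (H₁ ⊗[ℂ] H₂) (HTensor H₁ H₂) UniformSpace.Completion.toComplL ∘L
    TensorProduct.mkL ℂ H₁ H₂

lemma dense_span_tensorMk :
    Dense (Submodule.span ℂ {v | ∃ φ ψ, tensorMk H₁ H₂ φ ψ = v} : Set (HTensor H₁ H₂)) := by
  refine UniformSpace.Completion.denseRange_coe.mono ?_
  rintro _ ⟨z, rfl⟩
  induction z using TensorProduct.induction_on with
  | zero => exact UniformSpace.Completion.coe_zero (α := H₁ ⊗[ℂ] H₂) ▸ Submodule.zero_mem _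
  | tmul φ ψ => exact Submodule.subset_span ⟨φ, ψ, rfl⟩
  | add x y hx hy => exact UniformSpace.Completion.coe_add x y ▸ Submodule.add_mem _ hx hy

lemma HTensor.ext_inner_tensorMk {A B : HTensor H₁ H₂ →L[ℂ] HTensor H₁ H₂}
    (h : ∀ φ' φ ψ' ψ, ⟪tensorMk H₁ H₂ φ' ψ', A (tensorMk H₁ H₂ φ ψ)⟫_ℂ =
      ⟪tensorMk H₁ H₂ φ' ψ', B (tensorMk H₁ H₂ φ ψ)⟫_ℂ) : A = B := by
  refine ContinuousLinearMap.ext_on dense_span_tensorMk ?_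
  rintro _ ⟨φ, ψ, rfl⟩
  refine (innerSL_inj (𝕜 := ℂ)).1 (ContinuousLinearMap.ext_on dense_span_tensorMk ?_)
  rintro _ ⟨φ', ψ', rfl⟩
  rw [innerSL_apply_apply, innerSL_apply_apply, ← inner_conj_symm, h, inner_conj_symm]

lemma inner_opTensor_tensorMk (A : H₁ →L[ℂ] H₁) (B : H₂ →L[ℂ] H₂) (φ' φ : H₁) (ψ' ψ : H₂) :
    ⟪tensorMk H₁ H₂ φ' ψ', opTensor A B (tensorMk H₁ H₂ φ ψ)⟫_ℂ =
      ⟪φ', A φ⟫_ℂ * ⟪ψ', B ψ⟫_ℂ := by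
  have happly : opTensor A B (tensorMk H₁ H₂ φ ψ) = tensorMk H₁ H₂ (A φ) (B ψ) :=
    ContinuousLinearMap.completion_apply_coe _ _
  rw [happly]
  exact (UniformSpace.Completion.inner_coe _ _).trans (TensorProduct.inner_tmul _ _ _ _ _)

variable [CompleteSpace H₁] [CompleteSpace H₂]

lemma ptraceFst_eq_ptrace (ρ : HTensor H₁ H₂ →L[ℂ] HTensor H₁ H₂) :
    ptraceFst ρ = ptrace (tensorMk H₁ H₂) ρ := rfl

lemma ptraceSnd_eq_ptrace (ρ : HTensor H₁ H₂ →L[ℂ] HTensor H₁ H₂) :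
    ptraceSnd ρ = ptrace (tensorMk H₁ H₂).flip ρ := rfl

lemma eq_opTensor_of_mem_extremePoints {ρ : HTensor H₁ H₂ →L[ℂ] HTensor H₁ H₂} (hρ : 0 ≤ ρ)
    (h : ptraceFst ρ ∈ (states H₂).extremePoints ℝ ∨ ptraceSnd ρ ∈ (states H₁).extremePoints ℝ) :
    ρ = opTensor (ptraceSnd ρ) (ptraceFst ρ) := by
  refine HTensor.ext_inner_tensorMk fun φ' φ ψ' ψ => ?_
  rw [ptraceFst_eq_ptrace, ptraceSnd_eq_ptrace] at h ⊢
  rw [inner_opTensor_tensorMk]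
  rcases h with h | h
  · exact inner_eq_mul_of_mem_extremePoints hρ h φ' φ ψ' ψ
  · have hprod := inner_eq_mul_of_mem_extremePoints hρ h ψ' ψ φ' φ
    rwa [ContinuousLinearMap.flip_flip, ContinuousLinearMap.flip_apply,
      ContinuousLinearMap.flip_apply, mul_comm] at hprod

end HilbertTensor

section Broadcasting

open InnerProductSpace

variable {H : Type*} [NormedAddCommGroup H] [InnerProductSpace ℂ H] [CompleteSpace H]
variable {G : Type*} [NormedAddCommGroup G] [InnerProductSpace ℂ G] [CompleteSpace G]
variable {F : traceClass H →ₗ[ℂ] traceClass G} {τ : H →L[ℂ] H →L[ℂ] G}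

lemma eq_of_forall_inner_eq_mul {Y : H → H →L[ℂ] H} (hY : ∀ c, 0 ≤ Y c) {q : H → ℂ}
    (h : ∀ c φ, ⟪φ, Y c φ⟫_ℂ = q φ * (⟪φ, c⟫_ℂ * ⟪c, φ⟫_ℂ)) {φ ψ : H} (hφ : φ ≠ 0)
    (hψ : ψ ≠ 0) : q φ = q ψ := by
  have hconst : ∀ c, ∃ t, ∀ x, ⟪c, x⟫_ℂ ≠ 0 → q x = t := fun c => by
    obtain ⟨t, ht⟩ := exists_eq_smul_rankOne (hY c) fun y hy => by
      rw [h, hy, mul_zero, mul_zero]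
    refine ⟨t, fun x hx => ?_⟩
    have hx' : ⟪x, c⟫_ℂ ≠ 0 := mt inner_eq_zero_symm.1 hx
    have hform := h c x
    rw [ht, smul_apply, inner_smul_right, inner_right_rankOne_apply] at hform
    exact (mul_right_cancel₀ (mul_ne_zero hx' hx) hform).symm
  have hself : ∀ {x : H}, x ≠ 0 → ⟪x, x⟫_ℂ ≠ 0 := inner_self_ne_zero.2
  obtain ⟨c, hcφ, hcψ⟩ : ∃ c : H, ⟪c, φ⟫_ℂ ≠ 0 ∧ ⟪c, ψ⟫_ℂ ≠ 0 := by
    by_cases horth : ⟪φ, ψ⟫_ℂ = 0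
    · refine ⟨φ + ψ, ?_, ?_⟩
      · rw [inner_add_left, inner_eq_zero_symm.1 horth, add_zero]
        exact hself hφ
      · rw [inner_add_left, horth, zero_add]
        exact hself hψ
    · exact ⟨φ, hself hφ, horth⟩
  obtain ⟨t, ht⟩ := hconst c
  rw [ht φ hcφ, ht ψ hcψ]

namespace IsSchrodingerChannel

lemma exists_inner_eq (hF : IsSchrodingerChannel F) :
    ∃ E ∈ channels G H, ∀ T x y, ⟪y, (F T).1 x⟫_ℂ = tr (T.1 * E (rankOne ℂ x y)) := by
  obtain ⟨E, hE, hFE⟩ := hF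
  exact ⟨E, hE, fun T x y => by rw [← tr_mul_rankOne, hFE]⟩

lemma apply_rankOne_nonneg (hF : IsSchrodingerChannel F) (φ : H) :
    0 ≤ (F ⟨rankOne ℂ φ φ, rankOne_self_mem_traceClass φ⟩).1 := by
  obtain ⟨E, hE, hFE⟩ := hF.exists_inner_eq
  refine nonneg_iff_forall_inner_nonneg.2 fun x => ?_
  rw [hFE, tr_rankOne_mul]
  exact nonneg_iff_forall_inner_nonneg.1 (hE.1.nonneg (rankOne_self_nonneg x)) φ

lemma exists_inner_apply_rankOne_eq_mul (hF : IsSchrodingerChannel F)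
    (h : ∀ T, ptrace τ (F T).1 = T.1) (φ : H) : ∃ C : H →L[ℂ] H, ∀ α' α β' β,
      ⟪τ α' β', (F ⟨rankOne ℂ φ φ, rankOne_self_mem_traceClass φ⟩).1 (τ α β)⟫_ℂ =
        ⟪α', C α⟫_ℂ * (⟪β', φ⟫_ℂ * ⟪φ, β⟫_ℂ) := by
  rcases eq_or_ne φ 0 with rfl | hφ
  · obtain ⟨E, -, hFE⟩ := hF.exists_inner_eq
    exact ⟨0, fun α' α β' β => by rw [hFE, tr_rankOne_mul]; simp only [inner_zero_left, mul_zero]⟩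
  · obtain ⟨C, hC⟩ := exists_inner_eq_mul_of_isPure (hF.apply_rankOne_nonneg φ)
      (by rw [h]; exact isPure_rankOne hφ)
    refine ⟨C, fun α' α β' β => ?_⟩
    rw [hC, h, inner_right_rankOne_apply]

/-- The first factor of the output at `|φ⟩⟨φ|` does not depend on `φ`: the positive operator dual
to `|α ⊗ c⟩⟨α ⊗ c|` vanishes on the complement of `c`, so that it is a multiple of `|c⟩⟨c|`. -/
lemma exists_inner_eq_mul (hF : IsSchrodingerChannel F) (h : ∀ T, ptrace τ (F T).1 = T.1) :
    ∃ C : H →L[ℂ] H, ∀ T α' α β' β,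
      ⟪τ α' β', (F T).1 (τ α β)⟫_ℂ = ⟪α', C α⟫_ℂ * ⟪β', T.1 β⟫_ℂ := by
  obtain ⟨E, hE, hFE⟩ := hF.exists_inner_eq
  choose C hC using hF.exists_inner_apply_rankOne_eq_mul h
  have hquad : ∀ φ α' α β' β, ⟪φ, E (rankOne ℂ (τ α β) (τ α' β')) φ⟫_ℂ =
      ⟪α', C φ α⟫_ℂ * (⟪β', φ⟫_ℂ * ⟪φ, β⟫_ℂ) := fun φ α' α β' β => by
    rw [← hC, hFE, tr_rankOne_mul]
  obtain ⟨C₀, hC₀⟩ : ∃ C₀, ∀ φ, φ ≠ 0 → C φ = C₀ := by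
    by_cases hH : ∃ φ₀ : H, φ₀ ≠ 0
    · obtain ⟨φ₀, hφ₀⟩ := hH
      refine ⟨C φ₀, fun φ hφ => ext_inner_apply_self fun α => ?_⟩
      exact eq_of_forall_inner_eq_mul (Y := fun c => E (rankOne ℂ (τ α c) (τ α c)))
        (q := fun φ => ⟪α, C φ α⟫_ℂ) (fun c => hE.1.nonneg (rankOne_self_nonneg _))
        (fun c φ => by rw [hquad, mul_comm ⟪φ, c⟫_ℂ]) hφ hφ₀
    · exact ⟨0, fun φ hφ => (hH ⟨φ, hφ⟩).elim⟩
  have hdual : ∀ α' α β' β, E (rankOne ℂ (τ α β) (τ α' β')) =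
      ⟪α', C₀ α⟫_ℂ • rankOne ℂ β β' := fun α' α β' β => by
    refine ext_inner_apply_self fun φ => ?_
    rcases eq_or_ne φ 0 with rfl | hφ
    · rw [inner_zero_left, inner_zero_left]
    · rw [hquad, hC₀ φ hφ, smul_apply, inner_smul_right, inner_right_rankOne_apply,
        mul_comm ⟪φ, β⟫_ℂ]
  refine ⟨C₀, fun T α' α β' β => ?_⟩
  rw [hFE, hdual, mul_smul_comm, tr_smul, tr_mul_rankOne]

lemma exists_ptrace_flip_eq [Nontrivial H] (hF : IsSchrodingerChannel F)
    (h : ∀ T, ptrace τ (F T).1 = T.1) :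
    ∃ σ ∈ states H, ∀ T, ptrace τ.flip (F T).1 = tr T.1 • σ := by
  obtain ⟨C, hC⟩ := hF.exists_inner_eq_mul h
  obtain ⟨φ, hφ⟩ := exists_ne (0 : H)
  refine ⟨C, mem_states_of_inner_eq_mul (τ := τ) (hF.apply_rankOne_nonneg φ) ?_ ?_, fun T =>
    ptrace_flip_of_inner_eq_mul (hC T) T.2⟩
  · rw [h]
    exact rankOne_ne_zero hφ hφ
  · rw [h]
    exact hC _

lemma exists_ptraceSnd_eq [Nontrivial H] {F : traceClass H →ₗ[ℂ] traceClass (HTensor H H)}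
    (hF : IsSchrodingerChannel F) (h : ∀ T, ptraceFst (F T).1 = T.1) :
    ∃ σ ∈ states H, ∀ T, ptraceSnd (F T).1 = tr T.1 • σ :=
  hF.exists_ptrace_flip_eq (τ := tensorMk H H) h

lemma exists_ptraceFst_eq [Nontrivial H] {F : traceClass H →ₗ[ℂ] traceClass (HTensor H H)}
    (hF : IsSchrodingerChannel F) (h : ∀ T, ptraceSnd (F T).1 = T.1) :
    ∃ σ ∈ states H, ∀ T, ptraceFst (F T).1 = tr T.1 • σ :=
  hF.exists_ptrace_flip_eq (τ := (tensorMk H H).flip) h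

end IsSchrodingerChannel

end Broadcasting

end QJoint

theorem mainTheorem2_general
    {K : Type*} [NormedAddCommGroup K] [InnerProductSpace ℂ K] [CompleteSpace K]
    {H : Type*} [NormedAddCommGroup H] [InnerProductSpace ℂ H] [CompleteSpace H]
    {H₁ : Type*} [NormedAddCommGroup H₁] [InnerProductSpace ℂ H₁] [CompleteSpace H₁]
    {H₂ : Type*} [NormedAddCommGroup H₂] [InnerProductSpace ℂ H₂] [CompleteSpace H₂]
    {Ω : Type*} [MeasurableSpace Ω] {Ω' : Type*} [MeasurableSpace Ω']
    {ν : Measure Ω} {ν' : Measure Ω'} {μ : Measure (Ω × Ω')}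
    (hfst : Measure.QuasiMeasurePreserving Prod.fst μ ν)
    (hsnd : Measure.QuasiMeasurePreserving Prod.snd μ ν') :
  (∀ ρ ∈ states (HTensor H₁ H₂),
    (ptraceFst ρ ∈ (states H₂).extremePoints ℝ ∨ ptraceSnd ρ ∈ (states H₁).extremePoints ℝ) →
      ρ = opTensor (ptraceSnd ρ) (ptraceFst ρ)) ∧
  (∀ M₁ ∈ observablesOn H ν, ∀ M₂ ∈ observablesOn H ν',
    (∃ M ∈ observablesOn H μ, IsJointObservable M M₁ M₂) →
    ((M₁ ∈ (observablesOn H ν).extremePoints ℝ ∨ M₂ ∈ (observablesOn H ν').extremePoints ℝ) →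
      ∃! M, M ∈ observablesOn H μ ∧ IsJointObservable M M₁ M₂) ∧
    (M₁ ∈ (observablesOn H ν).extremePoints ℝ → M₂ ∈ (observablesOn H ν').extremePoints ℝ →
      ∀ M ∈ observablesOn H μ, IsJointObservable M M₁ M₂ →
        M ∈ (observablesOn H μ).extremePoints ℝ) ∧
    ((IsSharp M₁ ∨ IsSharp M₂) →
      (∀ X Y, MeasurableSet X → MeasurableSet Y → Commute (M₁ X) (M₂ Y)) ∧
      (∃! M, M ∈ observablesOn H μ ∧ IsJointObservable M M₁ M₂) ∧
      ∀ M ∈ observablesOn H μ, (IsJointObservable M M₁ M₂ ↔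
        ∀ X Y, MeasurableSet X → MeasurableSet Y → M (X ×ˢ Y) = M₁ X * M₂ Y))) ∧
  (∀ M ∈ observablesOn H ν, ∀ E ∈ channels K H,
    (∃ Γ ∈ instrumentsOn H K ν, IsJointInstrument Γ M E) →
    ((M ∈ (observablesOn H ν).extremePoints ℝ ∨ E ∈ (channels K H).extremePoints ℝ) →
      ∃! Γ, Γ ∈ instrumentsOn H K ν ∧ IsJointInstrument Γ M E) ∧
    (M ∈ (observablesOn H ν).extremePoints ℝ → E ∈ (channels K H).extremePoints ℝ →
      ∀ Γ ∈ instrumentsOn H K ν, IsJointInstrument Γ M E →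
        Γ ∈ (instrumentsOn H K ν).extremePoints ℝ) ∧
    ((IsSharp M ∨ IsStarRep E) →
      (∀ X B, MeasurableSet X → Commute (M X) (E B)) ∧
      (∃! Γ, Γ ∈ instrumentsOn H K ν ∧ IsJointInstrument Γ M E) ∧
      ∀ Γ ∈ instrumentsOn H K ν, IsJointInstrument Γ M E →
        ∀ X B, MeasurableSet X →
          Γ X B = M X * E B ∧ Γ X B = CFC.sqrt (M X) * E B * CFC.sqrt (M X))) ∧
  (Nontrivial H → ∀ F : traceClass H →ₗ[ℂ] traceClass (HTensor H H), IsSchrodingerChannel F →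
    ((∀ T, ptraceFst (F T).1 = T.1) →
      ∃ σ ∈ states H, ∀ T, ptraceSnd (F T).1 = tr T.1 • σ) ∧
    ((∀ T, ptraceSnd (F T).1 = T.1) →
      ∃ σ ∈ states H, ∀ T, ptraceFst (F T).1 = tr T.1 • σ)) := by
  refine ⟨fun ρ hρ h => eq_opTensor_of_mem_extremePoints hρ.1 h, ?_, ?_,
    fun _ F hF => ⟨hF.exists_ptraceSnd_eq, hF.exists_ptraceFst_eq⟩⟩
  · rintro M₁ hM₁ M₂ hM₂ ⟨M, hM, hMj⟩
    refine ⟨fun hext => ⟨M, ⟨hM, hMj⟩, fun N ⟨hN, hNj⟩ =>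
        hNj.eq_of_mem_extremePoints hN.1 hM.1 hM₁.1.1 hM₂.1.1 hMj hext⟩,
      fun hM₁ hM₂ N hN hNj => hNj.mem_extremePoints hfst hsnd hN hM₁ hM₂, fun hsharp =>
      ⟨fun X Y hX hY => hMj.commute_of_isSharp hM.1 hsharp hX hY, ?_, fun N hN =>
        isJointObservable_iff_apply_prod hN.1 hM₁.1.2.2 hM₂.1.2.2 hsharp⟩⟩
    exact ⟨M, ⟨hM, hMj⟩, fun N ⟨hN, hNj⟩ => hNj.eq_of_isSharp hN.1 hM.1 hMj hsharp⟩
  · rintro M - E - ⟨Γ, hΓ, hΓj⟩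
    refine ⟨fun hext => ⟨Γ, ⟨hΓ, hΓj⟩, fun Δ ⟨hΔ, hΔj⟩ => hext.elim
        (fun hM => hΔj.eq_of_observable_mem_extremePoints hM hΔ.1 hΓ.1 hΓj)
        (fun hE => hΔj.eq_of_channel_mem_extremePoints hE hΔ.1 hΓ.1 hΓj)⟩,
      fun hM hE Δ hΔ hΔj => hΔj.mem_extremePoints hΔ hM hE, fun h =>
      ⟨fun X B hX => hΓj.commute h hΓ.1 hX B, ?_, fun Δ hΔ hΔj X B hX =>
        ⟨(hΔj.apply_eq_mul h hΔ.1 hX B).1, hΔj.apply_eq_sqrt_mul_mul_sqrt h hΔ.1 hX B⟩⟩⟩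
    exact ⟨Γ, ⟨hΓ, hΓj⟩, fun Δ ⟨hΔ, hΔj⟩ => hΔj.eq_of_isSharp_or_isStarRep h hΔ.1 hΓ.1 hΓj⟩

theorem mainTheorem2
    {K : Type*} [NormedAddCommGroup K] [InnerProductSpace ℂ K] [CompleteSpace K]
    [TopologicalSpace.SeparableSpace K]
    {H : Type*} [NormedAddCommGroup H] [InnerProductSpace ℂ H] [CompleteSpace H]
    [TopologicalSpace.SeparableSpace H]
    {H₁ : Type*} [NormedAddCommGroup H₁] [InnerProductSpace ℂ H₁] [CompleteSpace H₁]
    [TopologicalSpace.SeparableSpace H₁]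
    {H₂ : Type*} [NormedAddCommGroup H₂] [InnerProductSpace ℂ H₂] [CompleteSpace H₂]
    [TopologicalSpace.SeparableSpace H₂]
    {Ω : Type*} [MeasurableSpace Ω] {Ω' : Type*} [MeasurableSpace Ω']
    (ν : Measure Ω) [SigmaFinite ν] (ν' : Measure Ω') [SigmaFinite ν'] :
  -- (a)
  (∀ ρ ∈ states (HTensor H₁ H₂),
    (ptraceFst ρ ∈ (states H₂).extremePoints ℝ ∨ ptraceSnd ρ ∈ (states H₁).extremePoints ℝ) →
      ρ = opTensor (ptraceSnd ρ) (ptraceFst ρ)) ∧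
  -- (b)&(e), relative to the measures `ν` and `ν'`
  (∀ M₁ ∈ observablesOn H ν, ∀ M₂ ∈ observablesOn H ν',
    (∃ M ∈ observablesOn H (ν.prod ν'), IsJointObservable M M₁ M₂) →
    ((M₁ ∈ (observablesOn H ν).extremePoints ℝ ∨ M₂ ∈ (observablesOn H ν').extremePoints ℝ) →
      ∃! M, M ∈ observablesOn H (ν.prod ν') ∧ IsJointObservable M M₁ M₂) ∧
    (M₁ ∈ (observablesOn H ν).extremePoints ℝ → M₂ ∈ (observablesOn H ν').extremePoints ℝ →
      ∀ M ∈ observablesOn H (ν.prod ν'), IsJointObservable M M₁ M₂ →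
        M ∈ (observablesOn H (ν.prod ν')).extremePoints ℝ) ∧
    ((IsSharp M₁ ∨ IsSharp M₂) →
      (∀ X Y, MeasurableSet X → MeasurableSet Y → Commute (M₁ X) (M₂ Y)) ∧
      (∃! M, M ∈ observablesOn H (ν.prod ν') ∧ IsJointObservable M M₁ M₂) ∧
      ∀ M ∈ observablesOn H (ν.prod ν'), (IsJointObservable M M₁ M₂ ↔
        ∀ X Y, MeasurableSet X → MeasurableSet Y → M (X ×ˢ Y) = M₁ X * M₂ Y))) ∧
  -- (b)&(e), for all POVMs on the given σ-algebras
  (∀ M₁ ∈ observables Ω H, ∀ M₂ ∈ observables Ω' H,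
    (∃ M ∈ observables (Ω × Ω') H, IsJointObservable M M₁ M₂) →
    ((M₁ ∈ (observables Ω H).extremePoints ℝ ∨ M₂ ∈ (observables Ω' H).extremePoints ℝ) →
      ∃! M, M ∈ observables (Ω × Ω') H ∧ IsJointObservable M M₁ M₂) ∧
    (M₁ ∈ (observables Ω H).extremePoints ℝ → M₂ ∈ (observables Ω' H).extremePoints ℝ →
      ∀ M ∈ observables (Ω × Ω') H, IsJointObservable M M₁ M₂ →
        M ∈ (observables (Ω × Ω') H).extremePoints ℝ) ∧
    ((IsSharp M₁ ∨ IsSharp M₂) →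
      (∀ X Y, MeasurableSet X → MeasurableSet Y → Commute (M₁ X) (M₂ Y)) ∧
      (∃! M, M ∈ observables (Ω × Ω') H ∧ IsJointObservable M M₁ M₂) ∧
      ∀ M ∈ observables (Ω × Ω') H, (IsJointObservable M M₁ M₂ ↔
        ∀ X Y, MeasurableSet X → MeasurableSet Y → M (X ×ˢ Y) = M₁ X * M₂ Y))) ∧
  -- (c)&(f), relative to the measure `ν`
  (∀ M ∈ observablesOn H ν, ∀ E ∈ channels K H,
    (∃ Γ ∈ instrumentsOn H K ν, IsJointInstrument Γ M E) →
    ((M ∈ (observablesOn H ν).extremePoints ℝ ∨ E ∈ (channels K H).extremePoints ℝ) →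
      ∃! Γ, Γ ∈ instrumentsOn H K ν ∧ IsJointInstrument Γ M E) ∧
    (M ∈ (observablesOn H ν).extremePoints ℝ → E ∈ (channels K H).extremePoints ℝ →
      ∀ Γ ∈ instrumentsOn H K ν, IsJointInstrument Γ M E →
        Γ ∈ (instrumentsOn H K ν).extremePoints ℝ) ∧
    ((IsSharp M ∨ IsStarRep E) →
      (∀ X B, MeasurableSet X → Commute (M X) (E B)) ∧
      (∃! Γ, Γ ∈ instrumentsOn H K ν ∧ IsJointInstrument Γ M E) ∧
      ∀ Γ ∈ instrumentsOn H K ν, IsJointInstrument Γ M E →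
        ∀ X B, MeasurableSet X →
          Γ X B = M X * E B ∧ Γ X B = CFC.sqrt (M X) * E B * CFC.sqrt (M X))) ∧
  -- (c)&(f), for all POVMs and instruments on the given σ-algebra
  (∀ M ∈ observables Ω H, ∀ E ∈ channels K H,
    (∃ Γ ∈ instruments Ω H K, IsJointInstrument Γ M E) →
    ((M ∈ (observables Ω H).extremePoints ℝ ∨ E ∈ (channels K H).extremePoints ℝ) →
      ∃! Γ, Γ ∈ instruments Ω H K ∧ IsJointInstrument Γ M E) ∧
    (M ∈ (observables Ω H).extremePoints ℝ → E ∈ (channels K H).extremePoints ℝ →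
      ∀ Γ ∈ instruments Ω H K, IsJointInstrument Γ M E →
        Γ ∈ (instruments Ω H K).extremePoints ℝ) ∧
    ((IsSharp M ∨ IsStarRep E) →
      (∀ X B, MeasurableSet X → Commute (M X) (E B)) ∧
      (∃! Γ, Γ ∈ instruments Ω H K ∧ IsJointInstrument Γ M E) ∧
      ∀ Γ ∈ instruments Ω H K, IsJointInstrument Γ M E →
        ∀ X B, MeasurableSet X →
          Γ X B = M X * E B ∧ Γ X B = CFC.sqrt (M X) * E B * CFC.sqrt (M X))) ∧
  -- (d), for either choice of the factor whose reduced output reproduces the input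
  (Nontrivial H → ∀ F : traceClass H →ₗ[ℂ] traceClass (HTensor H H), IsSchrodingerChannel F →
    ((∀ T, ptraceFst (F T).1 = T.1) →
      ∃ σ ∈ states H, ∀ T, ptraceSnd (F T).1 = tr T.1 • σ) ∧
    ((∀ T, ptraceSnd (F T).1 = T.1) →
      ∃ σ ∈ states H, ∀ T, ptraceFst (F T).1 = tr T.1 • σ)) := by
  obtain ⟨hstates, hobservables, hinstruments, hbroadcast⟩ :=
    mainTheorem2_general (K := K) (H := H) (H₁ := H₁) (H₂ := H₂)
      (Measure.quasiMeasurePreserving_fst (μ := ν) (ν := ν'))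
      (Measure.quasiMeasurePreserving_snd (μ := ν) (ν := ν'))
  obtain ⟨-, hobservables', hinstruments', -⟩ :=
    mainTheorem2_general (K := K) (H := H) (H₁ := H₁) (H₂ := H₂)
      (quasiMeasurePreserving_count (measurable_fst (α := Ω) (β := Ω')))
      (quasiMeasurePreserving_count measurable_snd)
  simp only [← observables_eq_observablesOn_count, ← instruments_eq_instrumentsOn_count]
    at hobservables' hinstruments'
  exact ⟨hstates, hobservables, hobservables', hinstruments, hinstruments', hbroadcast⟩
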